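/- Let $\mathbb{T}^\infty=\bigcup_{n\ge 0}(\mathbb{N}^*)^n$ be the Ulam--Harris--Neveu tree, rooted at the empty word. For $u,v\in\mathbb{T}^\infty$ let $h(u)$ be the height of $u$ (its length as a word), $u\wedge v$ the last common ancestor (longest common prefix) of $u$ and $v$, and $d(u,v)=h(u)+h(v)-2h(u\wedge v)$ the graph distance. For a sequence $(A_n)_{n\in\mathbb{N}}$ of finite non-empty subsets of $\mathbb{T}^\infty$, let $U_n,V_n$ be independent and uniformly distributed over $A_n$. The sequence $(A_n)$ satisfies - the *geometrical assumption* if for every $k\in\mathbb{N}$, $$\mathbb{P}(d(U_n,V_n)\le k)=|A_n|^{-2}\sum_{u,v\in A_n}\mathbf{1}_{\{d(u,v)\le k\}}\xrightarrow[n\to\infty]{}0;$$ - the *ancestral assumption* if for every $\varepsilon>0$ there is $k\in\mathbb{N}$ such that $\mathbb{P}(h(U_n\wedge V_n)>k)<\varepsilon$ for all $n$ large enough. For a random sequence $(A_n)$ these probabilities are taken conditionally on $(A_n)$. Let $T\subset\mathbb{T}^\infty$ be a Bienaymé--Galton--Watson tree whose offspring distribution on $\mathbb{N}$ has mean $m>1$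 and finite second moment, conditioned on non-extinction. Write $G_k=\{u\in T: h(u)=k\}$ for its $k$-th generation and $T_n=\bigcup_{k=0}^n G_k$ for the tree up to generation $n$. (i) Let $(\ell_n)_{n\in\mathbb{N}}$ be a (deterministic) sequence of integers with $0\le \ell_n\le n$ for all $n$, and let $A_n=\bigcup_{k=n-\ell_n}^n G_k$ be the set formed by the last $\ell_n+1$ generations of $T_n$. Then almost surely the sets $A_n$ are finite and non-empty and the sequence $(A_n)_{n\in\mathbb{N}}$ satisfies both the geometrical and the ancestral assumptions. (ii) Almost surely, the sequences $(G_n)_{n\in\mathbb{N}}$ and $(T_n)_{n\in\mathbb{N}}$ both satisfy the geometrical and the ancestral assumptions. -/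

import Mathlib

open MeasureTheory ProbabilityTheory Filter
open scoped Topology

/-- Vertices of the Ulam-Harris-Neveu tree: finite words of positive integers. The root is the
empty word and the children of `u` are the words `u ++ [i]`. -/
abbrev UHNVertex : Type := List ℕ+

namespace UHNVertex

/-- The height of a vertex: its number of letters. -/
def height (u : UHNVertex) : ℕ := List.length u

/-- The last common ancestor of two vertices: the longest common prefix of the two words. -/
def lca : UHNVertex → UHNVertex → UHNVertex
  | a :: u, b :: v => if a = b then a :: lca u v else []
  | _, _ => []

/-- The graph distance in the Ulam-Harris-Neveu tree. -/
def dist (u v : UHNVertex) : ℕ := height u + height v - 2 * height (lca u v)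

/-- A word is an ancestor (prefix) of `u` and of `v` exactly when it is one of `lca u v`. -/
theorem prefix_lca_iff (w u v : UHNVertex) : w <+: lca u v ↔ w <+: u ∧ w <+: v := by
  induction w generalizing u v with
  | nil => simp
  | cons c w ih =>
    cases u with
    | nil => simp [lca]
    | cons a u =>
      cases v with
      | nil => simp [lca]
      | cons b v =>
        by_cases hab : a = b
        · subst hab
          simp only [lca, if_true, List.cons_prefix_cons, ih]
          tauto
        · simp only [lca, if_neg hab, List.cons_prefix_cons]
          constructor
          · intro h
            simp at h
          · rintro ⟨⟨h1, _⟩, h2, _⟩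
            exact absurd (h1.symm.trans h2) hab

end UHNVertex

section Assumptions

/-- The probability that `R U V` holds, for `U` and `V` independent and uniformly distributed
over the finite non-empty set `A` of vertices: the proportion of the pairs in `A × A` related
by `R`. -/
noncomputable def uniformPairProb (A : Set UHNVertex) (R : UHNVertex → UHNVertex → Prop) : ℝ :=
  ({x : UHNVertex × UHNVertex | x.1 ∈ A ∧ x.2 ∈ A ∧ R x.1 x.2}.ncard : ℝ) / (A.ncard : ℝ) ^ 2

/-- The geometrical assumption: two independent uniform vertices of `A n` are far from each
other with high probability. -/
structure GeometricalAssumption (A : ℕ → Set UHNVertex) : Prop where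
  finite : ∀ n, (A n).Finite
  nonempty : ∀ n, (A n).Nonempty
  tendsto_prob : ∀ k : ℕ,
    Tendsto (fun n => uniformPairProb (A n) (fun u v => u.dist v ≤ k)) atTop (𝓝 0)

/-- The ancestral assumption: the height of the last common ancestor of two independent uniform
vertices of `A n` is tight. -/
structure AncestralAssumption (A : ℕ → Set UHNVertex) : Prop where
  finite : ∀ n, (A n).Finite
  nonempty : ∀ n, (A n).Nonempty
  tight : ∀ ε : ℝ, 0 < ε → ∃ k : ℕ, ∀ᶠ n in atTop,
    uniformPairProb (A n) (fun u v => k < (u.lca v).height) < ε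

end Assumptions

section Trees

/-- The `k`-th generation of a tree. -/
def treeGeneration (t : Set UHNVertex) (k : ℕ) : Set UHNVertex := {u | u ∈ t ∧ u.height = k}

/-- The tree `t` up to generation `n`. -/
def treeUpTo (t : Set UHNVertex) (n : ℕ) : Set UHNVertex := {u | u ∈ t ∧ u.height ≤ n}

/-- The last `l + 1` generations of the tree `t` up to generation `n`. -/
def lastGenerations (t : Set UHNVertex) (n l : ℕ) : Set UHNVertex :=
  ⋃ k ∈ Set.Icc (n - l) n, treeGeneration t k

/-- The tree in which every vertex `v` has the `ξ v` children `v ++ [1], …, v ++ [ξ v]`. -/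
def treeOfOffspring (ξ : UHNVertex → ℕ) : Set UHNVertex :=
  {u | ∀ (v : UHNVertex) (i : ℕ+), v ++ [i] <+: u → (i : ℕ) ≤ ξ v}

theorem nil_mem_treeOfOffspring (ξ : UHNVertex → ℕ) : [] ∈ treeOfOffspring ξ := by
  intro v i h
  simp at h

theorem append_mem_treeOfOffspring (ξ : UHNVertex → ℕ) (u : UHNVertex) (i : ℕ+) :
    u ++ [i] ∈ treeOfOffspring ξ ↔ u ∈ treeOfOffspring ξ ∧ (i : ℕ) ≤ ξ u := by
  constructor
  · intro h
    exact ⟨fun v j hv => h v j (hv.trans (List.prefix_append _ _)), h u i List.prefix_rfl⟩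
  · rintro ⟨h1, h2⟩ v j hv
    rcases List.prefix_concat_iff.mp hv with h | h
    · obtain ⟨rfl, h'⟩ := List.append_inj' h rfl
      cases h'
      exact h2
    · exact h1 v j h

theorem measurable_treeOfOffspring : Measurable treeOfOffspring := by
  refine measurable_pi_iff.2 fun u => ?_
  refine measurableSet_setOfPred.1 ?_
  have : {ξ : UHNVertex → ℕ | treeOfOffspring ξ u} =
      ⋂ (v : UHNVertex) (i : ℕ+) (_ : v ++ [i] <+: u), {ξ | (i : ℕ) ≤ ξ v} := by
    ext ξ
    simp only [Set.mem_iInter, Set.mem_ofPred_eq]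
    exact Iff.rfl
  rw [this]
  refine MeasurableSet.iInter fun v => MeasurableSet.iInter fun i => MeasurableSet.iInter fun _ => ?_
  exact measurableSet_le measurable_const (measurable_pi_apply v)

/-- The law of the Bienaymé-Galton-Watson tree with offspring distribution `p`: the vertices
have independent numbers of children with law `p`. The space `Set UHNVertex` carries the product
sigma-algebra, generated by the events `u ∈ t`. -/
noncomputable def bgwLaw (p : Measure ℕ) : Measure (Set UHNVertex) :=
  (Measure.infinitePi fun _ : UHNVertex => p).map treeOfOffspring

/-- Non-extinction: every generation is non-empty. -/
def survivalEvent : Set (Set UHNVertex) := {t | ∀ n, (treeGeneration t n).Nonempty}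

theorem measurableSet_survivalEvent : MeasurableSet survivalEvent := by
  have : survivalEvent =
      ⋂ n : ℕ, ⋃ (u : UHNVertex) (_ : u.height = n), {t : Set UHNVertex | u ∈ t} := by
    ext t
    simp only [survivalEvent, treeGeneration, Set.Nonempty, Set.mem_ofPred_eq, Set.mem_iInter,
      Set.mem_iUnion, exists_prop]
    exact forall_congr' fun n => exists_congr fun u => and_comm
  rw [this]
  exact MeasurableSet.iInter fun n => MeasurableSet.iUnion fun u => MeasurableSet.iUnion fun _ =>
    measurableSet_mem u

/-- `T` is a Bienaymé-Galton-Watson tree with offspring distribution `p`, conditioned on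
non-extinction: its law under `P` is the conditional law of such a tree given non-extinction. -/
def IsConditionedBGWTree {Ω : Type*} [MeasurableSpace Ω] (p : Measure ℕ) (T : Ω → Set UHNVertex)
    (P : Measure Ω) : Prop :=
  HasLaw T (ProbabilityTheory.cond (bgwLaw p) survivalEvent) P

end Trees

/-! All three families satisfy `G_n ⊆ A_n ⊆ T_n`, and a deterministic criterion handles any such
sequence. Suppose that eventually `|G_n| ≥ c m ^ n` with `c > 0`, that generation `j` of the subtree
above each `w ∈ T` has at most `m ^ j * b w` vertices, and that the sum of `b w ^ 2` over `T_n` is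
`o(m ^ (2n))`. Two vertices at distance at most `k` lie at most `k` levels below their last common
ancestor, so such pairs number at most a constant times `m ^ (2k)` times that sum. Pairs whose
common ancestor is higher than `K` share an ancestor of height `K`; their proportion is bounded,
uniformly in large `n`, by a constant times the normalised sum over `T_K`, which is small for large
`K` (`geometricalAssumption_of_bounds`, `ancestralAssumption_of_bounds`).

The hypotheses come from the martingale `Z_n / m ^ n`, where `Z_n = |G_n|`. Its increments have
second moment of order `m ^ (-n)`, so a weighted sum of their squares is integrable. By
Cauchy-Schwarz this sum bounds all `(Z_n / m ^ n) ^ 2` at once, giving an integrable `sizeBound`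
that plays the role of `b ^ 2`. By branching its expected sum over generation `j` is of order `m ^
j`, so the required limit holds almost surely (`ae_tsum_generationSum_ne_top`).

For the lower bound, the martingale limit has mean `1`, so exponential growth has positive
probability. Comparing the probabilities of extinction and of non-growth through the generating
function shows that they agree (`ae_extinct_or_growsLike`). -/

open scoped ENNReal

/-! ### The branching property and Wald's identities -/

/-- The offspring numbers in the subtree above the child `[i + 1]` of the root. -/
def offspringShift (i : ℕ) (ξ : UHNVertex → ℕ) : UHNVertex → ℕ := fun v => ξ (i.succPNat :: v)

theorem measurable_offspringShift (i : ℕ) : Measurable (offspringShift i) :=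
  measurable_pi_iff.2 fun _ => measurable_pi_apply _

/-- The root and the non-empty words are disjoint sets of coordinates, which gives independence;
injectivity of `(i, v) ↦ i :: v` identifies the second marginal. -/
theorem map_root_prod_tail (p : Measure ℕ) [IsProbabilityMeasure p] :
    (Measure.infinitePi fun _ : UHNVertex => p).map
      (fun ξ => (ξ [], fun q : ℕ × UHNVertex => ξ (q.1.succPNat :: q.2))) =
    p.prod (Measure.infinitePi fun _ : ℕ × UHNVertex => p) := by
  have hind : IndepFun (fun ξ : UHNVertex → ℕ => ξ [])
      (fun ξ (q : ℕ × UHNVertex) => ξ (q.1.succPNat :: q.2))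
      (Measure.infinitePi fun _ : UHNVertex => p) := by
    have h := iIndepFun_infinitePi (P := fun _ : UHNVertex => p) (X := fun _ k => k)
      (fun _ => measurable_id)
    have h2 := indep_iSup_of_disjoint (fun v => (measurable_pi_apply v).comap_le) h
      (S := {[]}) (T := {v | v ≠ []}) (by simp)
    refine indep_of_indep_of_le_left (indep_of_indep_of_le_right h2 ?_) ?_
    · simp only [MeasurableSpace.pi, MeasurableSpace.comap_iSup, MeasurableSpace.comap_comp]
      refine iSup_le fun q => ?_
      exact le_iSup₂_of_le (q.1.succPNat :: q.2) (by simp) le_rfl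
    · exact le_iSup₂_of_le [] rfl le_rfl
  rw [(indepFun_iff_map_prod_eq_prod_map_map (measurable_pi_apply _).aemeasurable
    (measurable_pi_iff.2 fun _ => measurable_pi_apply _).aemeasurable).1 hind]
  congr 1
  · exact Measure.infinitePi_map_eval _ _
  · refine Measure.map_infinitePi_infinitePi_of_inj (P := fun _ : UHNVertex => p)
      (f := fun q : ℕ × UHNVertex => q.1.succPNat :: q.2) ?_
    rintro ⟨a, u⟩ ⟨b, v⟩ h
    simp only [List.cons.injEq, Nat.succPNat_inj] at h
    exact Prod.ext h.1 h.2

/-- The branching property: the number of children of the root and the subtrees above them are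
independent, and these subtrees have the law of the whole tree. -/
theorem map_root_prod_offspringShift (p : Measure ℕ) [IsProbabilityMeasure p] :
    (Measure.infinitePi fun _ : UHNVertex => p).map (fun ξ => (ξ [], fun i => offspringShift i ξ)) =
    p.prod (Measure.infinitePi fun _ : ℕ => Measure.infinitePi fun _ : UHNVertex => p) := by
  rw [← Measure.infinitePi_map_curry (fun (_ : ℕ) (_ : UHNVertex) => p)]
  have h := Measure.map_prod_map p (Measure.infinitePi fun _ : ℕ × UHNVertex => p) measurable_id
    (MeasurableEquiv.curry ℕ UHNVertex ℕ).measurable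
  rw [Measure.map_id] at h
  have hm : Measurable (fun ξ : UHNVertex → ℕ =>
      (ξ [], fun q : ℕ × UHNVertex => ξ (q.1.succPNat :: q.2))) :=
    (measurable_pi_apply _).prodMk (measurable_pi_iff.2 fun _ => measurable_pi_apply _)
  rw [h, ← map_root_prod_tail, Measure.map_map (measurable_id.prodMap (MeasurableEquiv.measurable _))
    hm]
  rfl

section Branching

variable (p : Measure ℕ) [IsProbabilityMeasure p]

theorem measurable_root_prod_offspringShift :
    Measurable (fun ξ : UHNVertex → ℕ => (ξ [], fun i => offspringShift i ξ)) :=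
  (measurable_pi_apply _).prodMk (measurable_pi_iff.2 measurable_offspringShift)

/-- Fubini after the branching property: with the root's offspring number frozen, a random sum over
children becomes a sum of fixed length. -/
theorem lintegral_root_offspringShift {G : ℕ → (ℕ → UHNVertex → ℕ) → ℝ≥0∞}
    (hG : ∀ k, Measurable (G k)) :
    ∫⁻ ξ, G (ξ []) (fun i => offspringShift i ξ) ∂(Measure.infinitePi fun _ : UHNVertex => p) =
    ∫⁻ k, ∫⁻ η, G k η
      ∂(Measure.infinitePi fun _ : ℕ => Measure.infinitePi fun _ : UHNVertex => p) ∂p := by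
  have hG' : Measurable (Function.uncurry G) := measurable_from_prod_countable_right hG
  refine Eq.trans ?_ (lintegral_prod (Function.uncurry G) hG'.aemeasurable)
  rw [← map_root_prod_offspringShift, lintegral_map hG' measurable_root_prod_offspringShift]
  rfl

/-- The sum of a functional over the subtrees above the children of the root. -/
def childSum {M : Type*} [AddCommMonoid M] (F : (UHNVertex → ℕ) → M) (ξ : UHNVertex → ℕ) : M :=
  ∑ i ∈ Finset.range (ξ []), F (offspringShift i ξ)

theorem measurable_childSum {M : Type*} [AddCommMonoid M] [MeasurableSpace M] [MeasurableAdd₂ M]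
    {F : (UHNVertex → ℕ) → M} (hF : Measurable F) : Measurable (childSum F) := by
  have h : Measurable (Function.uncurry fun (k : ℕ) (η : ℕ → UHNVertex → ℕ) =>
      ∑ i ∈ Finset.range k, F (η i)) :=
    measurable_from_prod_countable_right fun k =>
      Finset.measurable_fun_sum (Finset.range k) fun i _ => hF.comp (measurable_pi_apply i)
  exact h.comp measurable_root_prod_offspringShift

theorem lintegral_childSum {F : (UHNVertex → ℕ) → ℝ≥0∞} (hF : Measurable F) :
    ∫⁻ ξ, childSum F ξ ∂(Measure.infinitePi fun _ : UHNVertex => p) =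
    (∫⁻ k, (k : ℝ≥0∞) ∂p) * ∫⁻ ξ, F ξ ∂(Measure.infinitePi fun _ : UHNVertex => p) := by
  have hF' : ∀ i, Measurable fun η : ℕ → UHNVertex → ℕ => F (η i) :=
    fun i => hF.comp (measurable_pi_apply i)
  refine (lintegral_root_offspringShift p (G := fun k η => ∑ i ∈ Finset.range k, F (η i))
    fun k => Finset.measurable_fun_sum _ fun i _ => hF' i).trans ?_
  rw [← lintegral_mul_const _ (by fun_prop)]
  refine lintegral_congr fun k => ?_
  rw [lintegral_finsetSum _ fun i _ => hF' i]
  have : ∀ i : ℕ, ∫⁻ η, F (η i)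
      ∂(Measure.infinitePi fun _ : ℕ => Measure.infinitePi fun _ : UHNVertex => p) =
      ∫⁻ ξ, F ξ ∂(Measure.infinitePi fun _ : UHNVertex => p) := fun i => by
    have h := measurePreserving_eval_infinitePi
      (fun _ : ℕ => Measure.infinitePi fun _ : UHNVertex => p) i
    exact h.lintegral_comp hF
  simp [this]

/-- Given `k` children, their subtrees are independent copies of the tree, hence a `k`-th power.
This is where the generating function of `p` enters. -/
theorem measure_forall_child {S : Set (UHNVertex → ℕ)} (hS : MeasurableSet S) :
    (Measure.infinitePi fun _ : UHNVertex => p) {ξ | ∀ i < ξ [], offspringShift i ξ ∈ S} =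
    ∫⁻ k, ((Measure.infinitePi fun _ : UHNVertex => p) S) ^ k ∂p := by
  have hm : ∀ k : ℕ, MeasurableSet (Set.pi (Finset.range k : Set ℕ) fun _ => S) := fun k =>
    MeasurableSet.pi (Finset.countable_toSet _) fun _ _ => hS
  have h1 : MeasurableSet {x : ℕ × (ℕ → UHNVertex → ℕ) |
      x.2 ∈ Set.pi (Finset.range x.1 : Set ℕ) fun _ => S} := by
    have : Measurable (Function.uncurry fun (k : ℕ) (η : ℕ → UHNVertex → ℕ) =>
        η ∈ Set.pi (Finset.range k : Set ℕ) fun _ => S) :=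
      measurable_from_prod_countable_right fun k => measurableSet_setOfPred.1 (hm k)
    exact measurableSet_setOfPred.2 this
  have h2 : {ξ : UHNVertex → ℕ | ∀ i < ξ [], offspringShift i ξ ∈ S} =
      (fun ξ : UHNVertex → ℕ => (ξ [], fun i => offspringShift i ξ)) ⁻¹'
        {x : ℕ × (ℕ → UHNVertex → ℕ) | x.2 ∈ Set.pi (Finset.range x.1 : Set ℕ) fun _ => S} := by
    ext ξ
    simp [Set.mem_pi]
  rw [h2, ← Measure.map_apply measurable_root_prod_offspringShift h1, map_root_prod_offspringShift,
    Measure.prod_apply h1]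
  refine lintegral_congr fun k => ?_
  have h3 := Measure.infinitePi_pi (fun _ : ℕ => Measure.infinitePi fun _ : UHNVertex => p)
    (s := Finset.range k) (t := fun _ => S) fun _ _ => hS
  simp only [Finset.prod_const, Finset.card_range] at h3
  exact h3

/-- Wald's identities for a centred functional. -/
theorem integral_childSum_of_centered (hp : Integrable (fun k : ℕ => (k : ℝ)) p)
    {F : (UHNVertex → ℕ) → ℝ} (hFm : Measurable F)
    (hF : MemLp F 2 (Measure.infinitePi fun _ : UHNVertex => p))
    (h0 : ∫ ξ, F ξ ∂(Measure.infinitePi fun _ : UHNVertex => p) = 0) :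
    ∫⁻ ξ, ENNReal.ofReal (childSum F ξ ^ 2) ∂(Measure.infinitePi fun _ : UHNVertex => p) =
      (∫⁻ k, (k : ℝ≥0∞) ∂p) *
        ∫⁻ ξ, ENNReal.ofReal (F ξ ^ 2) ∂(Measure.infinitePi fun _ : UHNVertex => p) ∧
    MemLp (childSum F) 2 (Measure.infinitePi fun _ : UHNVertex => p) ∧
    ∫ ξ, childSum F ξ ∂(Measure.infinitePi fun _ : UHNVertex => p) = 0 := by
  set μ := Measure.infinitePi fun _ : UHNVertex => p
  set M := Measure.infinitePi fun _ : ℕ => μ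
  have hmp : ∀ i : ℕ, MeasurePreserving (fun η : ℕ → UHNVertex → ℕ => η i) M μ :=
    fun i => measurePreserving_eval_infinitePi (fun _ : ℕ => μ) i
  have hL : ∀ i : ℕ, MemLp (fun η : ℕ → UHNVertex → ℕ => F (η i)) 2 M :=
    fun i => hF.comp_measurePreserving (hmp i)
  have hE : ∀ i : ℕ, ∫ η, F (η i) ∂M = 0 := fun i => by
    rw [← h0, ← (hmp i).map_eq, integral_map (hmp i).aemeasurable hFm.aestronglyMeasurable]
  have hS0 : ∀ k : ℕ, ∫ η, ∑ i ∈ Finset.range k, F (η i) ∂M = 0 := fun k => by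
    rw [integral_finsetSum _ fun i _ => (hL i).integrable (by norm_num)]
    simp [hE]
  have hvar : ∀ {α : Type} [MeasurableSpace α] {Q : Measure α} [IsProbabilityMeasure Q] {X : α → ℝ},
      MemLp X 2 Q → ∫ a, X a ∂Q = 0 →
      ∫⁻ a, ENNReal.ofReal (X a ^ 2) ∂Q = ENNReal.ofReal (variance X Q) := by
    intro α _ Q _ X hX hX0
    rw [variance_eq_integral hX.aemeasurable, hX0,
      ← ofReal_integral_eq_lintegral_ofReal hX.integrable_sq (ae_of_all _ fun _ => sq_nonneg _)]
    simp
  -- For a fixed number of children, independence and centring remove the cross terms.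
  have hkey : ∀ k : ℕ, ∫⁻ η, ENNReal.ofReal ((∑ i ∈ Finset.range k, F (η i)) ^ 2) ∂M =
      (k : ℝ≥0∞) * ∫⁻ ξ, ENNReal.ofReal (F ξ ^ 2) ∂μ := fun k => by
    rw [hvar (X := fun η : ℕ → UHNVertex → ℕ => ∑ i ∈ Finset.range k, F (η i))
      (memLp_finsetSum _ fun i _ => hL i) (hS0 k), hvar hF h0]
    have hind : iIndepFun (fun (i : ℕ) (η : ℕ → UHNVertex → ℕ) => F (η i)) M :=
      iIndepFun_infinitePi (P := fun _ : ℕ => μ) (X := fun _ => F) fun _ => hFm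
    have h := IndepFun.variance_sum (μ := M) (s := Finset.range k)
      (X := fun (i : ℕ) (η : ℕ → UHNVertex → ℕ) => F (η i)) (fun i _ => hL i)
      fun i _ j _ hij => hind.indepFun hij
    have h2 : ∀ i : ℕ, variance (fun η : ℕ → UHNVertex → ℕ => F (η i)) M = variance F μ :=
      fun i => by
        rw [← (hmp i).map_eq, variance_map hFm.aemeasurable (hmp i).aemeasurable]
        rfl
    simp only [h2, Finset.sum_const, Finset.card_range, nsmul_eq_mul] at h
    have h3 : (fun η : ℕ → UHNVertex → ℕ => ∑ i ∈ Finset.range k, F (η i)) =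
        ∑ i ∈ Finset.range k, fun η : ℕ → UHNVertex → ℕ => F (η i) := by
      ext η; simp
    rw [h3, h, ENNReal.ofReal_mul (by positivity), ENNReal.ofReal_natCast]
  have hsum : ∫⁻ ξ, ENNReal.ofReal (childSum F ξ ^ 2) ∂μ =
      (∫⁻ k, (k : ℝ≥0∞) ∂p) * ∫⁻ ξ, ENNReal.ofReal (F ξ ^ 2) ∂μ := by
    refine (lintegral_root_offspringShift p
      (G := fun k η => ENNReal.ofReal ((∑ i ∈ Finset.range k, F (η i)) ^ 2))
      fun k => by fun_prop).trans ?_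
    rw [← lintegral_mul_const _ (by fun_prop)]
    exact lintegral_congr hkey
  have hpfin : ∫⁻ k, (k : ℝ≥0∞) ∂p ≠ ∞ := by
    have := hp.lintegral_lt_top
    simp only [ENNReal.ofReal_natCast] at this
    exact this.ne
  have hFfin : ∫⁻ ξ, ENNReal.ofReal (F ξ ^ 2) ∂μ ≠ ∞ := hF.integrable_sq.lintegral_lt_top.ne
  -- The second moment was computed as a `lintegral`, which needs no prior integrability; its
  -- finiteness now yields square integrability.
  have hmem : MemLp (childSum F) 2 μ := by
    rw [memLp_two_iff_integrable_sq (measurable_childSum hFm).aestronglyMeasurable]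
    refine ⟨((measurable_childSum hFm).pow_const 2).aestronglyMeasurable, ?_⟩
    rw [hasFiniteIntegral_iff_ofReal (ae_of_all _ fun _ => sq_nonneg _), hsum]
    exact ENNReal.mul_lt_top hpfin.lt_top hFfin.lt_top
  refine ⟨hsum, hmem, ?_⟩
  have hm : Measurable (Function.uncurry fun (k : ℕ) (η : ℕ → UHNVertex → ℕ) =>
      ∑ i ∈ Finset.range k, F (η i)) :=
    measurable_from_prod_countable_right fun k =>
      Finset.measurable_fun_sum (Finset.range k) fun i _ => hFm.comp (measurable_pi_apply i)
  have hint : Integrable (Function.uncurry fun (k : ℕ) (η : ℕ → UHNVertex → ℕ) =>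
      ∑ i ∈ Finset.range k, F (η i)) (p.prod M) := by
    rw [← map_root_prod_offspringShift,
      integrable_map_measure hm.aestronglyMeasurable measurable_root_prod_offspringShift.aemeasurable]
    exact hmem.integrable (by norm_num)
  have h1 : ∫ ξ, childSum F ξ ∂μ = ∫ x, (Function.uncurry fun (k : ℕ) (η : ℕ → UHNVertex → ℕ) =>
      ∑ i ∈ Finset.range k, F (η i)) x ∂(p.prod M) := by
    rw [← map_root_prod_offspringShift,
      integral_map measurable_root_prod_offspringShift.aemeasurable hm.aestronglyMeasurable]
    rfl
  rw [h1, integral_prod _ hint]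
  simp [hS0]

end Branching

/-! ### Counting pairs through a common ancestor -/

namespace UHNVertex

theorem exists_append_lca (u v : UHNVertex) :
    ∃ u' v', u = lca u v ++ u' ∧ v = lca u v ++ v' ∧ List.length u' + List.length v' = dist u v := by
  obtain ⟨⟨u', hu⟩, ⟨v', hv⟩⟩ := (prefix_lca_iff (lca u v) u v).1 List.prefix_rfl
  refine ⟨u', v', hu.symm, hv.symm, ?_⟩
  have h1 := congrArg List.length hu
  have h2 := congrArg List.length hv
  simp only [List.length_append] at h1 h2
  simp only [dist, height]
  omega

end UHNVertex

/-- The subtree of the descendants of `w`, translated to the root. -/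
def subtreeAt (w : UHNVertex) (t : Set UHNVertex) : Set UHNVertex := {v | w ++ v ∈ t}

theorem ncard_treeUpTo_le (t : Set UHNVertex) (n : ℕ) :
    (treeUpTo t n).ncard ≤ ∑ j ∈ Finset.range (n + 1), (treeGeneration t j).ncard := by
  have : treeUpTo t n = ⋃ j ∈ Finset.range (n + 1), treeGeneration t j := by
    ext u
    simp [treeUpTo, treeGeneration]
  rw [this]
  exact Finset.set_ncard_biUnion_le _ _

theorem finite_treeUpTo {t : Set UHNVertex} (h : ∀ n, (treeGeneration t n).Finite) (n : ℕ) :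
    (treeUpTo t n).Finite := by
  refine ((Finset.range (n + 1)).finite_toSet.biUnion fun j _ => h j).subset fun u hu => ?_
  simp only [Finset.coe_range, Set.mem_Iio, Set.mem_iUnion]
  exact ⟨u.height, Nat.lt_succ_of_le hu.2, hu.1, rfl⟩

theorem finite_treeGeneration_subtreeAt {t : Set UHNVertex} (h : ∀ n, (treeGeneration t n).Finite)
    (w : UHNVertex) (n : ℕ) : (treeGeneration (subtreeAt w t) n).Finite := by
  refine Set.Finite.of_finite_image ((h (w.length + n)).subset ?_)
    (List.append_right_injective w).injOn
  rintro _ ⟨v, ⟨hv, rfl⟩, rfl⟩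
  exact ⟨hv, List.length_append⟩

/-- Union bound over the common ancestor `w`; `D w` holds the admissible positions relative to `w`.
-/
theorem ncard_pairs_le (F : Finset UHNVertex) (D : UHNVertex → Set UHNVertex)
    (hD : ∀ w, (D w).Finite) (S : Set (UHNVertex × UHNVertex))
    (h : ∀ x ∈ S, ∃ w ∈ F, ∃ u ∈ D w, ∃ v ∈ D w, x = (w ++ u, w ++ v)) :
    S.ncard ≤ ∑ w ∈ F, (D w).ncard ^ 2 := by
  have hsub : S ⊆ ⋃ w ∈ F, (fun y : UHNVertex × UHNVertex => (w ++ y.1, w ++ y.2)) ''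
      (D w ×ˢ D w) := by
    intro x hx
    obtain ⟨w, hw, u, hu, v, hv, rfl⟩ := h x hx
    exact Set.mem_biUnion hw ⟨(u, v), ⟨hu, hv⟩, rfl⟩
  refine (Set.ncard_le_ncard hsub ?_).trans ((Finset.set_ncard_biUnion_le _ _).trans ?_)
  · exact F.finite_toSet.biUnion fun w _ => ((hD w).prod (hD w)).image _
  · refine Finset.sum_le_sum fun w _ => (Set.ncard_image_le ((hD w).prod (hD w))).trans ?_
    rw [Set.ncard_prod, sq]

/-! ### The deterministic criterion -/

section Criterion

variable {t : Set UHNVertex} {m : ℝ} {b : UHNVertex → ℝ}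

/-- Since `m > 1`, the geometric sum over generations is comparable to its last term, at the cost of
the factor `m / (m - 1)`. -/
theorem ncard_treeUpTo_subtreeAt_le (hm : 1 < m)
    (hb : ∀ w ∈ t, ∀ j, ((treeGeneration (subtreeAt w t) j).ncard : ℝ) ≤ m ^ j * b w)
    {w : UHNVertex} (hw : w ∈ t) (r : ℕ) :
    ((treeUpTo (subtreeAt w t) r).ncard : ℝ) ^ 2 ≤ (m / (m - 1)) ^ 2 * m ^ (2 * r) * b w ^ 2 := by
  have hb0 : 0 ≤ b w := by
    have := hb w hw 0
    simp only [pow_zero, one_mul] at this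
    exact (Nat.cast_nonneg _).trans this
  have h1 : ((treeUpTo (subtreeAt w t) r).ncard : ℝ) ≤ m / (m - 1) * m ^ r * b w := by
    calc ((treeUpTo (subtreeAt w t) r).ncard : ℝ)
        ≤ ∑ j ∈ Finset.range (r + 1), ((treeGeneration (subtreeAt w t) j).ncard : ℝ) := by
          exact_mod_cast ncard_treeUpTo_le _ _
      _ ≤ ∑ j ∈ Finset.range (r + 1), m ^ j * b w := Finset.sum_le_sum fun j _ => hb w hw j
      _ = (m ^ (r + 1) - 1) / (m - 1) * b w := by rw [← Finset.sum_mul, geom_sum_eq hm.ne']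
      _ ≤ m / (m - 1) * m ^ r * b w := by
          refine mul_le_mul_of_nonneg_right ?_ hb0
          rw [div_mul_eq_mul_div]
          refine div_le_div_of_nonneg_right ?_ (by linarith)
          rw [pow_succ]; linarith
  calc _ ≤ (m / (m - 1) * m ^ r * b w) ^ 2 := by gcongr
    _ = _ := by ring

variable (hm : 1 < m) (hpre : ∀ u v, u ++ v ∈ t → u ∈ t) (hfin : ∀ n, (treeGeneration t n).Finite)
  (hb : ∀ w ∈ t, ∀ j, ((treeGeneration (subtreeAt w t) j).ncard : ℝ) ≤ m ^ j * b w)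
  (hlim : Tendsto (fun n => (∑ w ∈ (finite_treeUpTo hfin n).toFinset, b w ^ 2) / m ^ (2 * n))
    atTop (𝓝 0))
  {c : ℝ} (hc : 0 < c) (hgrow : ∀ᶠ n in atTop, c * m ^ n ≤ ((treeGeneration t n).ncard : ℝ))
  {A : ℕ → Set UHNVertex} (hA1 : ∀ n, treeGeneration t n ⊆ A n) (hA2 : ∀ n, A n ⊆ treeUpTo t n)

include hm hfin hc hgrow hA1 hA2 in
theorem eventually_uniformPairProb_le (R : UHNVertex → UHNVertex → Prop) (X : ℕ → ℝ)
    (hX : ∀ᶠ n in atTop,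
      ({x : UHNVertex × UHNVertex | x.1 ∈ A n ∧ x.2 ∈ A n ∧ R x.1 x.2}.ncard : ℝ) ≤ X n) :
    ∀ᶠ n in atTop, uniformPairProb (A n) R ≤ X n / m ^ (2 * n) * (1 / c ^ 2) := by
  filter_upwards [hgrow, hX] with n hn hXn
  have h1 : c * m ^ n ≤ ((A n).ncard : ℝ) :=
    hn.trans (by exact_mod_cast Set.ncard_le_ncard (hA1 n) ((finite_treeUpTo hfin n).subset (hA2 n)))
  have hpos : 0 < c * m ^ n := by positivity
  unfold uniformPairProb
  calc _ ≤ X n / (c * m ^ n) ^ 2 := by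
        refine div_le_div₀ ((Nat.cast_nonneg _).trans hXn) hXn (by positivity) ?_
        gcongr
    _ = _ := by
        field_simp
        ring

include hm hpre hb hlim hc hgrow hA1 hA2 in
theorem geometricalAssumption_of_bounds (hne : ∀ n, (treeGeneration t n).Nonempty) :
    GeometricalAssumption A where
  finite n := (finite_treeUpTo hfin n).subset (hA2 n)
  nonempty n := (hne n).mono (hA1 n)
  tendsto_prob k := by
    have hmem : ∀ n, ∀ w ∈ (finite_treeUpTo hfin n).toFinset, w ∈ t := fun n w hw =>
      ((Set.Finite.mem_toFinset _).1 hw).1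
    have key := eventually_uniformPairProb_le hm hfin hc hgrow hA1 hA2 (fun u v => u.dist v ≤ k)
      (fun n => (m / (m - 1)) ^ 2 * m ^ (2 * k) *
        ∑ w ∈ (finite_treeUpTo hfin n).toFinset, b w ^ 2) ?_
    · refine squeeze_zero' (Eventually.of_forall fun n => ?_) key ?_
      · unfold uniformPairProb; positivity
      · have := (hlim.const_mul ((m / (m - 1)) ^ 2 * m ^ (2 * k))).mul_const (1 / c ^ 2)
        simpa only [mul_zero, zero_mul, mul_div_assoc] using this
    · refine Eventually.of_forall fun n => ?_
      have h1 := ncard_pairs_le (finite_treeUpTo hfin n).toFinset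
        (fun w => treeUpTo (subtreeAt w t) k)
        (fun w => finite_treeUpTo (finite_treeGeneration_subtreeAt hfin w) k)
        {x : UHNVertex × UHNVertex | x.1 ∈ A n ∧ x.2 ∈ A n ∧ x.1.dist x.2 ≤ k} ?_
      · calc _ ≤ ((∑ w ∈ (finite_treeUpTo hfin n).toFinset,
              (treeUpTo (subtreeAt w t) k).ncard ^ 2 : ℕ) : ℝ) := by exact_mod_cast h1
          _ ≤ _ := by
            push_cast
            rw [Finset.mul_sum]
            exact Finset.sum_le_sum fun w hw => ncard_treeUpTo_subtreeAt_le hm hb (hmem n w hw) k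
      · rintro ⟨u, v⟩ ⟨hu, hv, hd⟩
        obtain ⟨u', v', hu', hv', hs⟩ := UHNVertex.exists_append_lca u v
        simp only at hu hv hd
        have hut := hA2 n hu
        have hvt := hA2 n hv
        have hl := congrArg List.length hu'
        rw [List.length_append] at hl
        -- The lengths of `u'` and `v'` add up to the distance, so each is at most `k`.
        refine ⟨u.lca v, ?_, u', ⟨?_, ?_⟩, v', ⟨?_, ?_⟩, Prod.ext hu' hv'⟩
        · rw [Set.Finite.mem_toFinset]
          refine ⟨hpre _ u' (hu' ▸ hut.1), ?_⟩
          have := hut.2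
          simp only [UHNVertex.height] at this ⊢
          omega
        · exact (hu' ▸ hut.1 : _ ∈ t)
        · simp only [UHNVertex.height]; omega
        · exact (hv' ▸ hvt.1 : _ ∈ t)
        · simp only [UHNVertex.height]; omega

include hm hpre hb hlim hc hgrow hA1 hA2 in
theorem ancestralAssumption_of_bounds (hne : ∀ n, (treeGeneration t n).Nonempty) :
    AncestralAssumption A where
  finite n := (finite_treeUpTo hfin n).subset (hA2 n)
  nonempty n := (hne n).mono (hA1 n)
  tight ε hε := by
    have hlim' := (hlim.const_mul ((m / (m - 1)) ^ 2)).mul_const (1 / c ^ 2)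
    rw [mul_zero, zero_mul] at hlim'
    obtain ⟨K, hK, hK1⟩ := ((hlim'.eventually (gt_mem_nhds hε)).and (eventually_ge_atTop 1)).exists
    refine ⟨K, ?_⟩
    have hmem : ∀ w ∈ (finite_treeUpTo hfin K).toFinset, w ∈ t := fun w hw =>
      ((Set.Finite.mem_toFinset _).1 hw).1
    have key := eventually_uniformPairProb_le hm hfin hc hgrow hA1 hA2
      (fun u v => K < (u.lca v).height)
      (fun n => (m / (m - 1)) ^ 2 * m ^ (2 * (n - K)) *
        ∑ w ∈ (finite_treeUpTo hfin K).toFinset, b w ^ 2) ?_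
    · filter_upwards [key, eventually_ge_atTop K] with n hn hnK
      -- The powers of `m` cancel, leaving exactly the quantity at `K`, independent of `n`.
      refine hn.trans_lt (lt_of_eq_of_lt ?_ hK)
      obtain ⟨r, rfl⟩ := Nat.exists_eq_add_of_le hnK
      have hm0 : m ≠ 0 := by linarith
      have : K + r - K = r := by omega
      rw [this]
      field_simp
      ring
    · refine Eventually.of_forall fun n => ?_
      have h1 := ncard_pairs_le (finite_treeUpTo hfin K).toFinset
        (fun w => treeUpTo (subtreeAt w t) (n - K))
        (fun w => finite_treeUpTo (finite_treeGeneration_subtreeAt hfin w) _)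
        {x : UHNVertex × UHNVertex | x.1 ∈ A n ∧ x.2 ∈ A n ∧ K < (x.1.lca x.2).height} ?_
      · calc _ ≤ ((∑ w ∈ (finite_treeUpTo hfin K).toFinset,
              (treeUpTo (subtreeAt w t) (n - K)).ncard ^ 2 : ℕ) : ℝ) := by exact_mod_cast h1
          _ ≤ _ := by
            push_cast
            rw [Finset.mul_sum]
            exact Finset.sum_le_sum fun w hw => ncard_treeUpTo_subtreeAt_le hm hb (hmem w hw) _
      · rintro ⟨u, v⟩ ⟨hu, hv, hd⟩
        obtain ⟨u', v', hu', hv', -⟩ := UHNVertex.exists_append_lca u v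
        simp only [UHNVertex.height] at hu hv hd
        have hut := hA2 n hu
        have hvt := hA2 n hv
        set w : UHNVertex := u.lca v
        -- The common ancestor is cut at height exactly `K`, which leaves at most `n - K` letters in
        -- each remaining word.
        have hlw : (w.take K).length = K := by rw [List.length_take]; omega
        have hsplit : ∀ x : UHNVertex, w ++ x = w.take K ++ (w.drop K ++ x) := fun x => by
          rw [← List.append_assoc, List.take_append_drop]
        have hu2 : u = w.take K ++ (w.drop K ++ u') := hu'.trans (hsplit u')
        have hv2 : v = w.take K ++ (w.drop K ++ v') := hv'.trans (hsplit v')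
        have hlu := congrArg List.length hu2
        have hlv := congrArg List.length hv2
        rw [List.length_append, hlw] at hlu hlv
        have hun := hut.2
        have hvn := hvt.2
        simp only [UHNVertex.height] at hun hvn
        refine ⟨w.take K, ?_, w.drop K ++ u', ⟨?_, ?_⟩, w.drop K ++ v', ⟨?_, ?_⟩, Prod.ext hu2 hv2⟩
        · rw [Set.Finite.mem_toFinset]
          exact ⟨hpre _ _ (hu2 ▸ hut.1 : w.take K ++ (w.drop K ++ u') ∈ t), hlw.le⟩
        · exact (hu2 ▸ hut.1 : w.take K ++ (w.drop K ++ u') ∈ t)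
        · simp only [UHNVertex.height]; omega
        · exact (hv2 ▸ hvt.1 : w.take K ++ (w.drop K ++ v') ∈ t)
        · simp only [UHNVertex.height]; omega

end Criterion

/-! ### Measurability in the tree -/

section Measurability

theorem measurable_uniformPairProb (R : UHNVertex → UHNVertex → Prop) :
    Measurable fun A : Set UHNVertex => uniformPairProb A R := by
  have h1 : Measurable fun A : Set UHNVertex =>
      {x : UHNVertex × UHNVertex | x.1 ∈ A ∧ x.2 ∈ A ∧ R x.1 x.2} := by
    refine measurable_set_iff.2 fun x => ?_
    exact (measurable_set_mem x.1).and ((measurable_set_mem x.2).and measurable_const)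
  have h2 : Measurable fun A : Set UHNVertex => (A.ncard : ℝ) :=
    measurable_from_top.comp measurable_ncard
  have h3 := (measurable_from_top (f := fun n : ℕ => (n : ℝ))).comp (measurable_ncard.comp h1)
  exact h3.div (h2.pow_const 2)

theorem measurableSet_finite_nonempty {B : ℕ → Set UHNVertex → Set UHNVertex}
    (hB : ∀ n, Measurable (B n)) :
    MeasurableSet {t | ∀ n, (B n t).Finite ∧ (B n t).Nonempty} := by
  have h1 : {t | ∀ n, (B n t).Finite ∧ (B n t).Nonempty} =
      ⋂ n, ((fun t => (B n t).encard) ⁻¹' {⊤})ᶜ ∩ ⋃ u, {t | u ∈ B n t} := by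
    ext t
    simp [Set.encard_eq_top_iff, Set.Nonempty]
  rw [h1]
  refine MeasurableSet.iInter fun n => MeasurableSet.inter ?_ (MeasurableSet.iUnion fun u => ?_)
  · exact ((measurable_encard.comp (hB n)) (measurableSet_singleton _)).compl
  · exact measurableSet_setOfPred.2 ((measurable_set_mem u).comp (hB n))

/-- Needed to transfer an almost sure statement between the offspring field, the law of the tree and
`T`. Testing `ε = 1 / (j + 1)` keeps the operations countable. -/
theorem measurableSet_geometrical_ancestral {B : ℕ → Set UHNVertex → Set UHNVertex}
    (hB : ∀ n, Measurable (B n)) :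
    MeasurableSet {t | GeometricalAssumption (fun n => B n t) ∧
      AncestralAssumption (fun n => B n t)} := by
  have h1 : {t | GeometricalAssumption (fun n => B n t) ∧ AncestralAssumption (fun n => B n t)} =
      {t | ∀ n, (B n t).Finite ∧ (B n t).Nonempty} ∩
      ((⋂ k : ℕ, {t | Tendsto (fun n => uniformPairProb (B n t) (fun u v => u.dist v ≤ k))
        atTop (𝓝 0)}) ∩
      ⋂ j : ℕ, ⋃ k : ℕ, ⋃ N : ℕ, ⋂ n : ℕ, ⋂ _ : N ≤ n,
        {t | uniformPairProb (B n t) (fun u v => k < (u.lca v).height) < 1 / ((j : ℝ) + 1)}) := by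
    ext t
    simp only [Set.mem_inter_iff, Set.mem_iInter, Set.mem_iUnion, Set.mem_ofPred_eq]
    constructor
    · rintro ⟨hg, ha⟩
      refine ⟨fun n => ⟨hg.finite n, hg.nonempty n⟩, hg.tendsto_prob, fun j => ?_⟩
      obtain ⟨k, hk⟩ := ha.tight (1 / ((j : ℝ) + 1)) (by positivity)
      obtain ⟨N, hN⟩ := eventually_atTop.1 hk
      exact ⟨k, N, hN⟩
    · rintro ⟨hf, hg, ha⟩
      refine ⟨⟨fun n => (hf n).1, fun n => (hf n).2, hg⟩,
        ⟨fun n => (hf n).1, fun n => (hf n).2, fun ε hε => ?_⟩⟩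
      obtain ⟨j, hj⟩ := exists_nat_one_div_lt hε
      obtain ⟨k, N, hN⟩ := ha j
      exact ⟨k, eventually_atTop.2 ⟨N, fun n hn => (hN n hn).trans hj⟩⟩
  have h2 : ∀ R n, Measurable fun t => uniformPairProb (B n t) R :=
    fun R n => (measurable_uniformPairProb R).comp (hB n)
  rw [h1]
  refine (measurableSet_finite_nonempty hB).inter (MeasurableSet.inter ?_ ?_)
  · exact MeasurableSet.iInter fun k => measurableSet_tendsto _ fun n => h2 _ n
  · exact MeasurableSet.iInter fun j => MeasurableSet.iUnion fun k => MeasurableSet.iUnion fun N =>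
      MeasurableSet.iInter fun n => MeasurableSet.iInter fun _ =>
        measurableSet_lt (h2 _ n) measurable_const

theorem measurable_treeGeneration (n : ℕ) : Measurable fun t => treeGeneration t n :=
  measurable_set_iff.2 fun u => (measurable_set_mem u).and measurable_const

theorem measurable_treeUpTo (n : ℕ) : Measurable fun t => treeUpTo t n :=
  measurable_set_iff.2 fun u => (measurable_set_mem u).and measurable_const

theorem mem_lastGenerations_iff {t : Set UHNVertex} {n l : ℕ} {u : UHNVertex} :
    u ∈ lastGenerations t n l ↔ u ∈ t ∧ n - l ≤ u.height ∧ u.height ≤ n := by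
  simp only [lastGenerations, treeGeneration, Set.mem_iUnion, Set.mem_Icc, Set.mem_ofPred_eq,
    exists_prop]
  constructor
  · rintro ⟨_, ⟨h1, h2⟩, h3, rfl⟩
    exact ⟨h3, h1, h2⟩
  · rintro ⟨h3, h1, h2⟩
    exact ⟨_, ⟨h1, h2⟩, h3, rfl⟩

theorem measurable_lastGenerations (n l : ℕ) : Measurable fun t => lastGenerations t n l := by
  refine measurable_set_iff.2 fun u => ?_
  simp only [mem_lastGenerations_iff]
  exact (measurable_set_mem u).and measurable_const

end Measurability

/-! ### Sums over a generation -/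

section GenerationSums

/-- The sum of a functional over the subtrees above the vertices of generation `n`. -/
def generationSum {M : Type*} [AddCommMonoid M] (F : (UHNVertex → ℕ) → M) :
    ℕ → (UHNVertex → ℕ) → M
  | 0 => F
  | n + 1 => childSum (generationSum F n)

/-- The number of vertices of generation `n`. -/
def generationSize (n : ℕ) (ξ : UHNVertex → ℕ) : ℕ := generationSum (fun _ => 1) n ξ

/-- The offspring numbers in the subtree above `w`. -/
def offspringAbove (w : UHNVertex) (ξ : UHNVertex → ℕ) : UHNVertex → ℕ := fun v => ξ (w ++ v)

variable {M : Type*} [AddCommMonoid M]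

/-- The definition unfolds from the root; this unfolds from the last generation, as needed to count
generation `n + 1` by parents in generation `n`. -/
theorem generationSum_succ' (F : (UHNVertex → ℕ) → M) (n : ℕ) :
    generationSum F (n + 1) = generationSum (childSum F) n := by
  induction n with
  | zero => rfl
  | succ n ih =>
    change childSum (generationSum F (n + 1)) = _
    rw [ih]
    rfl

theorem map_generationSum {N : Type*} [AddCommMonoid N] (φ : M →+ N) (F : (UHNVertex → ℕ) → M)
    (n : ℕ) (ξ : UHNVertex → ℕ) :
    φ (generationSum F n ξ) = generationSum (fun ξ => φ (F ξ)) n ξ := by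
  induction n generalizing ξ with
  | zero => rfl
  | succ n ih =>
    simp only [generationSum, childSum, map_sum]
    exact Finset.sum_congr rfl fun i _ => ih _

theorem measurable_generationSum [MeasurableSpace M] [MeasurableAdd₂ M]
    {F : (UHNVertex → ℕ) → M} (hF : Measurable F) (n : ℕ) : Measurable (generationSum F n) := by
  induction n with
  | zero => exact hF
  | succ n ih => exact measurable_childSum ih

theorem measurable_generationSize (n : ℕ) : Measurable (generationSize n) :=
  measurable_generationSum measurable_const n

theorem cons_mem_treeOfOffspring {ξ : UHNVertex → ℕ} {i : ℕ} {u : UHNVertex} :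
    i.succPNat :: u ∈ treeOfOffspring ξ ↔
      i < ξ [] ∧ u ∈ treeOfOffspring (offspringShift i ξ) := by
  constructor
  · intro h
    refine ⟨h [] i.succPNat (by simp), fun v j hv => h (i.succPNat :: v) j ?_⟩
    rw [List.cons_append, List.cons_prefix_cons]
    exact ⟨rfl, hv⟩
  · rintro ⟨h1, h2⟩ v j hv
    cases v with
    | nil =>
      rw [List.nil_append, List.cons_prefix_cons] at hv
      rw [hv.1]
      exact h1
    | cons a v =>
      rw [List.cons_append, List.cons_prefix_cons] at hv
      rw [hv.1]
      exact h2 v j hv.2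

theorem treeGeneration_zero (ξ : UHNVertex → ℕ) : treeGeneration (treeOfOffspring ξ) 0 = {[]} := by
  ext u
  simp only [treeGeneration, UHNVertex.height, Set.mem_ofPred_eq, Set.mem_singleton_iff,
    List.length_eq_zero_iff]
  exact ⟨fun h => h.2, fun h => ⟨h ▸ nil_mem_treeOfOffspring ξ, h⟩⟩

theorem treeGeneration_succ (ξ : UHNVertex → ℕ) (n : ℕ) :
    treeGeneration (treeOfOffspring ξ) (n + 1) = ⋃ i ∈ Finset.range (ξ []),
      List.cons i.succPNat '' treeGeneration (treeOfOffspring (offspringShift i ξ)) n := by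
  ext u
  simp only [Set.mem_iUnion, Set.mem_image, Finset.mem_range, exists_prop]
  constructor
  · rintro ⟨h1, h2⟩
    cases u with
    | nil => simp [UHNVertex.height] at h2
    | cons a u =>
      rw [← PNat.succPNat_natPred a, cons_mem_treeOfOffspring] at h1
      refine ⟨a.natPred, h1.1, u, ⟨h1.2, ?_⟩, by rw [PNat.succPNat_natPred]⟩
      simpa [UHNVertex.height] using h2
  · rintro ⟨i, hi, u, ⟨hu1, hu2⟩, rfl⟩
    exact ⟨cons_mem_treeOfOffspring.2 ⟨hi, hu1⟩, by simpa [UHNVertex.height] using hu2⟩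

theorem finite_treeGeneration (ξ : UHNVertex → ℕ) (n : ℕ) :
    (treeGeneration (treeOfOffspring ξ) n).Finite := by
  induction n generalizing ξ with
  | zero => rw [treeGeneration_zero]; exact Set.finite_singleton _
  | succ n ih =>
    rw [treeGeneration_succ]
    exact (Finset.range (ξ [])).finite_toSet.biUnion fun i _ => (ih _).image _

/-- Links the recursion, suited to the branching property, with sums over actual vertices, suited to
the criterion. -/
theorem sum_treeGeneration (F : (UHNVertex → ℕ) → M) (n : ℕ) (ξ : UHNVertex → ℕ) :
    ∑ w ∈ (finite_treeGeneration ξ n).toFinset, F (offspringAbove w ξ) = generationSum F n ξ := by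
  induction n generalizing ξ with
  | zero =>
    have : (finite_treeGeneration ξ 0).toFinset = {[]} := by
      ext w
      simp [treeGeneration_zero]
    rw [this, Finset.sum_singleton]
    rfl
  | succ n ih =>
    have : (finite_treeGeneration ξ (n + 1)).toFinset = (Finset.range (ξ [])).biUnion fun i =>
        (finite_treeGeneration (offspringShift i ξ) n).toFinset.map
          ⟨List.cons i.succPNat, List.cons_injective⟩ := by
      ext w
      simp [treeGeneration_succ]
    rw [this, Finset.sum_biUnion]
    · refine Finset.sum_congr rfl fun i _ => ?_
      rw [Finset.sum_map, ← ih]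
      rfl
    · intro i _ j _ hij
      simp only [Function.onFun, Finset.disjoint_left, Finset.mem_map, Function.Embedding.coeFn_mk]
      rintro _ ⟨u, -, rfl⟩ ⟨v, -, h⟩
      simp only [List.cons.injEq, Nat.succPNat_inj] at h
      exact hij h.1.symm

theorem ncard_treeGeneration (n : ℕ) (ξ : UHNVertex → ℕ) :
    (treeGeneration (treeOfOffspring ξ) n).ncard = generationSize n ξ := by
  rw [Set.ncard_eq_toFinset_card _ (finite_treeGeneration ξ n), Finset.card_eq_sum_ones]
  exact sum_treeGeneration (fun _ => 1) n ξ

theorem mem_treeOfOffspring_of_append {ξ : UHNVertex → ℕ} (u v : UHNVertex)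
    (h : u ++ v ∈ treeOfOffspring ξ) : u ∈ treeOfOffspring ξ :=
  fun w i hw => h w i (hw.trans (List.prefix_append _ _))

theorem subtreeAt_treeOfOffspring {ξ : UHNVertex → ℕ} {w : UHNVertex}
    (hw : w ∈ treeOfOffspring ξ) :
    subtreeAt w (treeOfOffspring ξ) = treeOfOffspring (offspringAbove w ξ) := by
  induction w generalizing ξ with
  | nil => rfl
  | cons a w ih =>
    rw [← PNat.succPNat_natPred a, cons_mem_treeOfOffspring] at hw
    have h := ih hw.2
    have h2 : offspringAbove w (offspringShift a.natPred ξ) = offspringAbove (a :: w) ξ := by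
      funext v
      simp [offspringAbove, offspringShift]
    rw [← h2, ← h]
    ext v
    simp only [subtreeAt, Set.mem_ofPred_eq, List.cons_append]
    rw [← PNat.succPNat_natPred a, cons_mem_treeOfOffspring]
    simp [hw.1]

theorem sum_treeUpTo (F : (UHNVertex → ℕ) → M) (n : ℕ) (ξ : UHNVertex → ℕ) :
    ∑ w ∈ (finite_treeUpTo (finite_treeGeneration ξ) n).toFinset, F (offspringAbove w ξ) =
      ∑ j ∈ Finset.range (n + 1), generationSum F j ξ := by
  have : (finite_treeUpTo (finite_treeGeneration ξ) n).toFinset =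
      (Finset.range (n + 1)).biUnion fun j => (finite_treeGeneration ξ j).toFinset := by
    ext w
    simp [treeUpTo, treeGeneration, and_comm]
  rw [this, Finset.sum_biUnion]
  · exact Finset.sum_congr rfl fun j _ => sum_treeGeneration F j ξ
  · intro i _ j _ hij
    simp only [Function.onFun, Finset.disjoint_left, Set.Finite.mem_toFinset]
    rintro u ⟨-, h1⟩ ⟨-, h2⟩
    exact hij (h1.symm.trans h2)

theorem generationSize_succ (n : ℕ) (ξ : UHNVertex → ℕ) :
    generationSize (n + 1) ξ = childSum (generationSize n) ξ := rfl

theorem generationSize_succ' (n : ℕ) (ξ : UHNVertex → ℕ) :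
    generationSize (n + 1) ξ = generationSum (fun ξ => ξ []) n ξ := by
  unfold generationSize
  rw [generationSum_succ']
  congr 1
  funext ξ
  simp [childSum]

end GenerationSums

/-! ### The normalised generation sizes and their pathwise bound -/

section Martingale

variable (m : ℝ)

/-- The difference between the size of generation `n + 1` and its conditional mean given the
first `n` generations. -/
def generationNoise (n : ℕ) (ξ : UHNVertex → ℕ) : ℝ := generationSum (fun ξ => (ξ [] : ℝ) - m) n ξ

theorem measurable_generationNoise (n : ℕ) : Measurable (generationNoise m n) := by
  refine measurable_generationSum (Measurable.sub_const ?_ m) n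
  exact measurable_from_top.comp (measurable_pi_apply ([] : UHNVertex))

theorem generationNoise_eq (n : ℕ) (ξ : UHNVertex → ℕ) :
    generationNoise m n ξ = generationSize (n + 1) ξ - m * generationSize n ξ := by
  rw [generationSize_succ', generationSize]
  have h1 := map_generationSum (Nat.castAddMonoidHom ℝ) (fun ξ : UHNVertex → ℕ => ξ []) n ξ
  have h2 := map_generationSum (Nat.castAddMonoidHom ℝ) (fun _ : UHNVertex → ℕ => 1) n ξ
  simp only [Nat.coe_castAddMonoidHom, Nat.cast_one] at h1 h2
  rw [h1, h2, generationNoise, ← sum_treeGeneration, ← sum_treeGeneration, ← sum_treeGeneration,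
    Finset.sum_sub_distrib, Finset.mul_sum]
  simp

/-- Telescoping: the summands are the increments of the normalised sizes. -/
theorem generationSize_eq (hm : 1 < m) (n : ℕ) (ξ : UHNVertex → ℕ) :
    (generationSize n ξ : ℝ) / m ^ n =
      1 + ∑ i ∈ Finset.range n, generationNoise m i ξ / m ^ (i + 1) := by
  induction n with
  | zero => simp [generationSize, generationSum]
  | succ n ih =>
    rw [Finset.sum_range_succ, ← add_assoc, ← ih, generationNoise_eq]
    have : m ≠ 0 := by linarith
    field_simp
    ring

/-- A weighted sum of squares of the martingale increments, which bounds the normalised generation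
sizes. -/
noncomputable def noiseEnergy (ξ : UHNVertex → ℕ) : ℝ≥0∞ :=
  ∑' i, ENNReal.ofReal (√m ^ i * (generationNoise m i ξ / m ^ (i + 1)) ^ 2)

theorem measurable_noiseEnergy : Measurable (noiseEnergy m) :=
  Measurable.tsum fun i =>
    ((((measurable_generationNoise m i).div_const _).pow_const 2).const_mul _).ennreal_ofReal

variable {m}

/-- Cauchy-Schwarz with weights `√m ^ (-i)` and `√m ^ i`. It gives summability and a bound uniform
in `n` together, in place of a maximal inequality. -/
theorem sq_sum_abs_noise_le (hm : 1 < m) {ξ : UHNVertex → ℕ} (h : noiseEnergy m ξ ≠ ∞) (n : ℕ) :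
    (∑ i ∈ Finset.range n, |generationNoise m i ξ / m ^ (i + 1)|) ^ 2 ≤
      √m / (√m - 1) * (noiseEnergy m ξ).toReal := by
  have hs : 1 < √m := by rw [Real.lt_sqrt zero_le_one]; simpa using hm
  have hs0 : 0 < √m := by linarith
  set a : ℕ → ℝ := fun i => generationNoise m i ξ / m ^ (i + 1)
  have h1 := Finset.sum_sq_le_sum_mul_sum_of_sq_le_mul (Finset.range n) (r := fun i => |a i|)
    (f := fun i => (√m)⁻¹ ^ i) (g := fun i => √m ^ i * a i ^ 2) (fun i _ => by positivity)
    (fun i _ => by positivity) (fun i _ => by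
      rw [sq_abs, ← mul_assoc, ← mul_pow, inv_mul_cancel₀ hs0.ne', one_pow, one_mul])
  refine h1.trans ?_
  have h2 : ∑ i ∈ Finset.range n, (√m)⁻¹ ^ i ≤ √m / (√m - 1) := by
    have h3 := (summable_geometric_of_lt_one (inv_nonneg.2 hs0.le) (inv_lt_one_of_one_lt₀ hs))
    refine (h3.sum_le_tsum _ fun i _ => by positivity).trans_eq ?_
    rw [tsum_geometric_of_lt_one (inv_nonneg.2 hs0.le) (inv_lt_one_of_one_lt₀ hs)]
    have : √m - 1 ≠ 0 := by linarith
    field_simp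
  have h4 : ∑ i ∈ Finset.range n, √m ^ i * a i ^ 2 ≤ (noiseEnergy m ξ).toReal := by
    rw [← ENNReal.ofReal_le_iff_le_toReal h, ENNReal.ofReal_sum_of_nonneg fun i _ => by positivity]
    exact ENNReal.sum_le_tsum _
  have h5 : 0 ≤ ∑ i ∈ Finset.range n, √m ^ i * a i ^ 2 :=
    Finset.sum_nonneg fun i _ => by positivity
  exact mul_le_mul h2 h4 h5 (div_nonneg hs0.le (by linarith))

theorem summable_noise (hm : 1 < m) {ξ : UHNVertex → ℕ} (h : noiseEnergy m ξ ≠ ∞) :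
    Summable fun i => generationNoise m i ξ / m ^ (i + 1) := by
  refine Summable.of_abs (summable_of_sum_range_le (c := √(√m / (√m - 1) *
    (noiseEnergy m ξ).toReal)) (fun _ => abs_nonneg _) fun n => ?_)
  exact Real.le_sqrt_of_sq_le (sq_sum_abs_noise_le hm h n)

/-- A bound for the squares of the normalised generation sizes. -/
noncomputable def sizeBound (m : ℝ) (ξ : UHNVertex → ℕ) : ℝ≥0∞ :=
  2 + ENNReal.ofReal (2 * (√m / (√m - 1))) * noiseEnergy m ξ

theorem measurable_sizeBound (m : ℝ) : Measurable (sizeBound m) :=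
  ((measurable_noiseEnergy m).const_mul _).const_add _

theorem noiseEnergy_ne_top (hm : 1 < m) {ξ : UHNVertex → ℕ} (h : sizeBound m ξ ≠ ∞) :
    noiseEnergy m ξ ≠ ∞ := by
  intro h'
  have hs : 1 < √m := by rw [Real.lt_sqrt zero_le_one]; simpa using hm
  have : 0 < 2 * (√m / (√m - 1)) := by
    have : 0 < √m - 1 := by linarith
    positivity
  apply h
  rw [sizeBound, h', ENNReal.mul_top (ENNReal.ofReal_pos.2 this).ne', add_top]

theorem sq_generationSize_le (hm : 1 < m) {ξ : UHNVertex → ℕ} (h : sizeBound m ξ ≠ ∞) (n : ℕ) :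
    ((generationSize n ξ : ℝ) / m ^ n) ^ 2 ≤ (sizeBound m ξ).toReal := by
  have hQ := noiseEnergy_ne_top hm h
  have hs : 1 < √m := by rw [Real.lt_sqrt zero_le_one]; simpa using hm
  have hC : 0 ≤ 2 * (√m / (√m - 1)) := by
    have : 0 < √m - 1 := by linarith
    positivity
  have h1 := sq_sum_abs_noise_le hm hQ n
  have h2 : (∑ i ∈ Finset.range n, generationNoise m i ξ / m ^ (i + 1)) ^ 2 ≤
      (∑ i ∈ Finset.range n, |generationNoise m i ξ / m ^ (i + 1)|) ^ 2 := by
    rw [← sq_abs]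
    gcongr
    exact Finset.abs_sum_le_sum_abs _ _
  rw [generationSize_eq m hm, sizeBound, ENNReal.toReal_add (by simp)
    (ENNReal.mul_ne_top ENNReal.ofReal_ne_top hQ), ENNReal.toReal_mul, ENNReal.toReal_ofReal hC]
  simp only [ENNReal.toReal_ofNat]
  -- This is `(1 + x) ^ 2 ≤ 2 + 2 * x ^ 2`, the origin of the constants in `sizeBound`.
  nlinarith [sq_nonneg (1 - ∑ i ∈ Finset.range n, generationNoise m i ξ / m ^ (i + 1))]

theorem generationSize_le (hm : 1 < m) {ξ : UHNVertex → ℕ} (h : sizeBound m ξ ≠ ∞) (n : ℕ) :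
    (generationSize n ξ : ℝ) ≤ m ^ n * √(sizeBound m ξ).toReal := by
  have h1 := Real.le_sqrt_of_sq_le (sq_generationSize_le hm h n)
  rwa [div_le_iff₀' (by positivity)] at h1

end Martingale

/-! ### Moments and almost sure summability -/

section Moments

variable (p : Measure ℕ) [IsProbabilityMeasure p]

theorem lintegral_generationSum {F : (UHNVertex → ℕ) → ℝ≥0∞} (hF : Measurable F) (n : ℕ) :
    ∫⁻ ξ, generationSum F n ξ ∂(Measure.infinitePi fun _ : UHNVertex => p) =
    (∫⁻ k, (k : ℝ≥0∞) ∂p) ^ n * ∫⁻ ξ, F ξ ∂(Measure.infinitePi fun _ : UHNVertex => p) := by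
  induction n with
  | zero => simp [generationSum]
  | succ n ih =>
    rw [generationSum, lintegral_childSum p (measurable_generationSum hF n), ih, pow_succ']
    ring

variable {p} {m : ℝ}

omit [IsProbabilityMeasure p] in
theorem memLp_offspring (hsq : Integrable (fun k : ℕ => (k : ℝ) ^ 2) p) :
    MemLp (fun k : ℕ => (k : ℝ)) 2 p :=
  (memLp_two_iff_integrable_sq measurable_from_top.aestronglyMeasurable).2 hsq

theorem lintegral_offspring (hsq : Integrable (fun k : ℕ => (k : ℝ) ^ 2) p)
    (hmean : ∫ k : ℕ, (k : ℝ) ∂p = m) : ∫⁻ k, (k : ℝ≥0∞) ∂p = ENNReal.ofReal m := by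
  rw [← hmean, ofReal_integral_eq_lintegral_ofReal
    ((memLp_offspring hsq).integrable (by norm_num)) (ae_of_all _ fun _ => Nat.cast_nonneg _)]
  simp

/-- Each generation multiplies the second moment by `m` and preserves centring, by Wald's
identities. -/
theorem generationNoise_moments (hsq : Integrable (fun k : ℕ => (k : ℝ) ^ 2) p)
    (hmean : ∫ k : ℕ, (k : ℝ) ∂p = m) (n : ℕ) :
    ∫⁻ ξ, ENNReal.ofReal (generationNoise m n ξ ^ 2)
      ∂(Measure.infinitePi fun _ : UHNVertex => p) =
      ENNReal.ofReal m ^ n * ∫⁻ k : ℕ, ENNReal.ofReal (((k : ℝ) - m) ^ 2) ∂p ∧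
    MemLp (generationNoise m n) 2 (Measure.infinitePi fun _ : UHNVertex => p) ∧
    ∫ ξ, generationNoise m n ξ ∂(Measure.infinitePi fun _ : UHNVertex => p) = 0 := by
  have hL := memLp_offspring hsq
  have hI : Integrable (fun k : ℕ => (k : ℝ)) p := hL.integrable (by norm_num)
  induction n with
  | zero =>
    have hmp : MeasurePreserving (fun ξ : UHNVertex → ℕ => ξ [])
        (Measure.infinitePi fun _ : UHNVertex => p) p :=
      measurePreserving_eval_infinitePi (fun _ : UHNVertex => p) []
    refine ⟨?_, ?_, ?_⟩
    · rw [pow_zero, one_mul]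
      exact hmp.lintegral_comp (f := fun k : ℕ => ENNReal.ofReal (((k : ℝ) - m) ^ 2))
        measurable_from_top
    · exact (hL.sub (memLp_const m)).comp_measurePreserving hmp
    · have h : ∫ k : ℕ, ((k : ℝ) - m) ∂p = 0 := by
        rw [integral_sub hI (integrable_const _), hmean]
        simp
      rw [← h, ← hmp.map_eq, integral_map hmp.aemeasurable measurable_from_top.aestronglyMeasurable,
        hmp.map_eq]
      rfl
  | succ n ih =>
    obtain ⟨h1, h2, h3⟩ := integral_childSum_of_centered p hI (measurable_generationNoise m n)
      ih.2.1 ih.2.2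
    refine ⟨h1.trans ?_, h2, h3⟩
    rw [ih.1, lintegral_offspring hsq hmean, pow_succ', mul_assoc]

/-- The squared increments have mean of order `m ^ (-i)`; after the weight `√m ^ i` there remains
the summable `√m ^ (-i)`. -/
theorem lintegral_noiseEnergy_ne_top (hm : 1 < m)
    (hsq : Integrable (fun k : ℕ => (k : ℝ) ^ 2) p) (hmean : ∫ k : ℕ, (k : ℝ) ∂p = m) :
    ∫⁻ ξ, noiseEnergy m ξ ∂(Measure.infinitePi fun _ : UHNVertex => p) ≠ ∞ := by
  have hs : 1 < √m := by rw [Real.lt_sqrt zero_le_one]; simpa using hm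
  have hs0 : 0 < √m := by linarith
  have hm0 : 0 < m := by linarith
  set V := ∫⁻ k : ℕ, ENNReal.ofReal (((k : ℝ) - m) ^ 2) ∂p
  have hV : V ≠ ∞ :=
    ((memLp_offspring hsq).sub (memLp_const m)).integrable_sq.lintegral_lt_top.ne
  unfold noiseEnergy
  rw [lintegral_tsum fun i => ((((measurable_generationNoise m i).div_const _).pow_const
    2).const_mul _).ennreal_ofReal.aemeasurable]
  have h : ∀ i, ∫⁻ ξ, ENNReal.ofReal (√m ^ i * (generationNoise m i ξ / m ^ (i + 1)) ^ 2)
      ∂(Measure.infinitePi fun _ : UHNVertex => p) =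
      ENNReal.ofReal ((√m)⁻¹ ^ i * (m ^ 2)⁻¹) * V := fun i => by
    have h1 : ∀ ξ, ENNReal.ofReal (√m ^ i * (generationNoise m i ξ / m ^ (i + 1)) ^ 2) =
        ENNReal.ofReal (√m ^ i / m ^ (2 * (i + 1))) *
          ENNReal.ofReal (generationNoise m i ξ ^ 2) := fun ξ => by
      rw [← ENNReal.ofReal_mul (by positivity), div_pow, ← pow_mul, mul_comm (i + 1) 2]
      congr 1
      ring
    simp only [h1]
    rw [lintegral_const_mul _ ((measurable_generationNoise m i).pow_const 2).ennreal_ofReal,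
      (generationNoise_moments hsq hmean i).1, ← mul_assoc, ← ENNReal.ofReal_pow hm0.le,
      ← ENNReal.ofReal_mul (by positivity)]
    congr 2
    have h2 : m = √m * √m := (Real.mul_self_sqrt hm0.le).symm
    rw [inv_pow, div_mul_eq_mul_div, div_eq_iff (by positivity), ← mul_inv, inv_mul_eq_div,
      eq_div_iff (by positivity)]
    calc √m ^ i * m ^ i * (√m ^ i * m ^ 2) = (√m * √m) ^ i * m ^ i * m ^ 2 := by ring
      _ = m ^ (2 * (i + 1)) := by rw [← h2]; ring
  simp only [h]
  rw [ENNReal.tsum_mul_right]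
  refine ENNReal.mul_ne_top ?_ hV
  exact ((summable_geometric_of_lt_one (inv_nonneg.2 hs0.le)
    (inv_lt_one_of_one_lt₀ hs)).mul_right _).tsum_ofReal_ne_top

theorem lintegral_sizeBound_ne_top (hm : 1 < m)
    (hsq : Integrable (fun k : ℕ => (k : ℝ) ^ 2) p) (hmean : ∫ k : ℕ, (k : ℝ) ∂p = m) :
    ∫⁻ ξ, sizeBound m ξ ∂(Measure.infinitePi fun _ : UHNVertex => p) ≠ ∞ := by
  unfold sizeBound
  rw [lintegral_add_left measurable_const,
    lintegral_const_mul _ (measurable_noiseEnergy m)]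
  simp only [lintegral_const, measure_univ, mul_one]
  exact ENNReal.add_ne_top.2 ⟨by simp, ENNReal.mul_ne_top ENNReal.ofReal_ne_top
    (lintegral_noiseEnergy_ne_top hm hsq hmean)⟩

/-- The inner sum has mean of order `m ^ n`, so the `n`-th term has mean of order `m ^ (-n)`.
Finiteness of the series will force its terms to tend to `0`. -/
theorem ae_tsum_generationSum_ne_top (hm : 1 < m)
    (hsq : Integrable (fun k : ℕ => (k : ℝ) ^ 2) p) (hmean : ∫ k : ℕ, (k : ℝ) ∂p = m) :
    ∀ᵐ ξ ∂(Measure.infinitePi fun _ : UHNVertex => p),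
      ∑' n : ℕ, ENNReal.ofReal (1 / m ^ (2 * n)) *
        ∑ j ∈ Finset.range (n + 1), generationSum (sizeBound m) j ξ ≠ ∞ := by
  have hm0 : 0 < m := by linarith
  have hmeas : ∀ n : ℕ, Measurable fun ξ => ∑ j ∈ Finset.range (n + 1),
      generationSum (sizeBound m) j ξ := fun n => Finset.measurable_fun_sum _ fun j _ =>
    measurable_generationSum (measurable_sizeBound m) j
  have key : ∫⁻ ξ, ∑' n : ℕ, ENNReal.ofReal (1 / m ^ (2 * n)) *
      ∑ j ∈ Finset.range (n + 1), generationSum (sizeBound m) j ξ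
      ∂(Measure.infinitePi fun _ : UHNVertex => p) ≠ ∞ := by
    rw [lintegral_tsum fun n => ((hmeas n).const_mul _).aemeasurable]
    set K := ∫⁻ ξ, sizeBound m ξ ∂(Measure.infinitePi fun _ : UHNVertex => p)
    have h : ∀ n : ℕ, ∫⁻ ξ, ENNReal.ofReal (1 / m ^ (2 * n)) *
        ∑ j ∈ Finset.range (n + 1), generationSum (sizeBound m) j ξ
        ∂(Measure.infinitePi fun _ : UHNVertex => p) ≤
        ENNReal.ofReal (m / (m - 1) * m⁻¹ ^ n) * K := fun n => by
      rw [lintegral_const_mul _ (hmeas n), lintegral_finsetSum _ fun j _ =>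
        measurable_generationSum (measurable_sizeBound m) j]
      simp only [lintegral_generationSum p (measurable_sizeBound m), lintegral_offspring hsq hmean]
      rw [← Finset.sum_mul, ← mul_assoc]
      simp only [← ENNReal.ofReal_pow hm0.le]
      rw [← ENNReal.ofReal_sum_of_nonneg fun i _ => by positivity,
        ← ENNReal.ofReal_mul (by positivity), geom_sum_eq hm.ne']
      refine mul_le_mul_left (ENNReal.ofReal_le_ofReal ?_) _
      have h1 : 0 < m - 1 := by linarith
      calc 1 / m ^ (2 * n) * ((m ^ (n + 1) - 1) / (m - 1))
          ≤ 1 / m ^ (2 * n) * (m ^ (n + 1) / (m - 1)) := by gcongr; linarith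
        _ = m / (m - 1) * m⁻¹ ^ n := by
          rw [two_mul, pow_add, pow_succ, inv_pow]
          field_simp
    refine ne_top_of_le_ne_top ?_ (ENNReal.tsum_le_tsum h)
    rw [ENNReal.tsum_mul_right]
    refine ENNReal.mul_ne_top ?_ (lintegral_sizeBound_ne_top hm hsq hmean)
    exact ((summable_geometric_of_lt_one (inv_nonneg.2 hm0.le)
      (inv_lt_one_of_one_lt₀ hm)).mul_left _).tsum_ofReal_ne_top
  filter_upwards [ae_lt_top (Measurable.tsum fun n => (hmeas n).const_mul _) key] with ξ hξ
  exact hξ.ne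

theorem integral_limit_eq_one (hm : 1 < m)
    (hsq : Integrable (fun k : ℕ => (k : ℝ) ^ 2) p) (hmean : ∫ k : ℕ, (k : ℝ) ∂p = m) :
    ∫ ξ, (1 + ∑' i, generationNoise m i ξ / m ^ (i + 1))
      ∂(Measure.infinitePi fun _ : UHNVertex => p) = 1 := by
  have hfin := lintegral_sizeBound_ne_top hm hsq hmean
  have hae := ae_lt_top (measurable_sizeBound m) hfin
  have hW : ∀ n, ∫ ξ, (1 + ∑ i ∈ Finset.range n, generationNoise m i ξ / m ^ (i + 1))
      ∂(Measure.infinitePi fun _ : UHNVertex => p) = 1 := fun n => by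
    have hi : ∀ i, Integrable (fun ξ => generationNoise m i ξ / m ^ (i + 1))
        (Measure.infinitePi fun _ : UHNVertex => p) := fun i =>
      ((generationNoise_moments hsq hmean i).2.1.integrable (by norm_num)).div_const _
    rw [integral_add (integrable_const _) (integrable_finsetSum _ fun i _ => hi i),
      integral_finsetSum _ fun i _ => hi i]
    simp [integral_div, (generationNoise_moments hsq hmean _).2.2]
  have hlim := tendsto_integral_of_dominated_convergence
    (μ := Measure.infinitePi fun _ : UHNVertex => p)
    (F := fun n ξ => 1 + ∑ i ∈ Finset.range n, generationNoise m i ξ / m ^ (i + 1))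
    (f := fun ξ => 1 + ∑' i, generationNoise m i ξ / m ^ (i + 1))
    (fun ξ => 1 + (sizeBound m ξ).toReal)
    (fun n => (measurable_const.add (Finset.measurable_fun_sum _ fun i _ =>
      (measurable_generationNoise m i).div_const _)).aestronglyMeasurable)
    ((integrable_const _).add (integrable_toReal_of_lintegral_ne_top
      (measurable_sizeBound m).aemeasurable hfin)) ?_ ?_
  · simp only [hW] at hlim
    exact tendsto_nhds_unique hlim tendsto_const_nhds
  · intro n
    filter_upwards [hae] with ξ hξ
    rw [← generationSize_eq m hm, Real.norm_of_nonneg (by positivity)]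
    have := sq_generationSize_le hm hξ.ne n
    -- Domination uses `x ≤ 1 + x ^ 2`.
    nlinarith [sq_nonneg ((generationSize n ξ : ℝ) / m ^ n - 1)]
  · filter_upwards [hae] with ξ hξ
    exact (summable_noise hm (noiseEnergy_ne_top hm hξ.ne)).hasSum.tendsto_sum_nat.const_add 1

end Moments

/-! ### Extinction or exponential growth -/

section Survival

/-- The generating function of a law on `ℕ` of mean larger than `1` has at most one fixed point in
`[0, 1)`: a point where it is at least the identity is not larger than one where it is at most the
identity. -/
theorem le_of_generatingFunction {p : Measure ℕ} [IsProbabilityMeasure p]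
    (hmean : 1 < ∫ k : ℕ, (k : ℝ) ∂p) {e q : ℝ} (he : 0 ≤ e) (hq : q < 1)
    (hef : ∫ k : ℕ, e ^ k ∂p ≤ e) (hqf : q ≤ ∫ k : ℕ, q ^ k ∂p) : q ≤ e := by
  by_contra! hlt
  have hint : ∀ x : ℝ, 0 ≤ x → x ≤ 1 → Integrable (fun k : ℕ => x ^ k) p := fun x h0 h1 =>
    Integrable.of_bound measurable_from_top.aestronglyMeasurable 1 (ae_of_all _ fun k => by
      rw [Real.norm_of_nonneg (by positivity)]
      exact pow_le_one₀ h0 h1)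
  have he1 : 0 < 1 - e := by linarith
  -- If `e < q < 1`, then `q` is the convex combination of `e` and `1` with weight `a` on `e`.
  set a : ℝ := (1 - q) / (1 - e)
  have ha0 : 0 < a := div_pos (by linarith) he1
  have ha1 : 0 < 1 - a := by
    rw [sub_pos, div_lt_one he1]; linarith
  have hqa : q = a * e + (1 - a) * 1 := by
    have : a * (1 - e) = 1 - q := div_mul_cancel₀ _ he1.ne'
    linarith
  have hconv : ∀ k : ℕ, q ^ k ≤ a * e ^ k + (1 - a) := fun k => by
    have := (convexOn_pow k).2 (x := e) (y := 1) he (Set.mem_Ici.2 zero_le_one) ha0.le ha1.le (by ring)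
    simp only [smul_eq_mul, one_pow, mul_one] at this
    rw [mul_one] at hqa
    rwa [← hqa] at this
  have hstrict : ∀ k : ℕ, 2 ≤ k → q ^ k < a * e ^ k + (1 - a) := fun k hk => by
    have := (strictConvexOn_pow hk).2 (x := e) (y := 1) he (Set.mem_Ici.2 zero_le_one) (by linarith) ha0 ha1
      (by ring)
    simp only [smul_eq_mul, one_pow, mul_one] at this
    rw [mul_one] at hqa
    rwa [← hqa] at this
  have hq0 : 0 ≤ q := he.trans hlt.le
  have hIq := hint q hq0 hq.le
  have hIe := hint e he (by linarith)
  have hI2 : Integrable (fun k : ℕ => a * e ^ k + (1 - a)) p :=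
    (hIe.const_mul a).add (integrable_const _)
  -- The chord bound integrates to at most `a * e + (1 - a) = q`, itself at most the integral of `q
  -- ^ k`, so equality holds almost everywhere.
  have hzero : ∫ k : ℕ, (a * e ^ k + (1 - a) - q ^ k) ∂p = 0 := by
    refine le_antisymm ?_ (integral_nonneg fun k => sub_nonneg.2 (hconv k))
    rw [integral_sub hI2 hIq, integral_add (hIe.const_mul a) (integrable_const _),
      integral_const_mul]
    simp only [integral_const, probReal_univ, one_smul]
    have := mul_le_mul_of_nonneg_left hef ha0.le
    linarith
  have hae := (integral_eq_zero_iff_of_nonneg (fun k => sub_nonneg.2 (hconv k))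
    (hI2.sub hIq)).1 hzero
  -- Strict convexity for `k ≥ 2` confines `p` to `{0, 1}`, so its mean is at most `1`.
  have hle : ∫ k : ℕ, (k : ℝ) ∂p ≤ ∫ k : ℕ, (1 : ℝ) ∂p := by
    refine integral_mono_of_nonneg (ae_of_all _ fun k => Nat.cast_nonneg _) (integrable_const _) ?_
    filter_upwards [hae] with k hk
    by_contra! h
    have h2 : 2 ≤ k := by exact_mod_cast h
    have h3 := hstrict k h2
    simp only [Pi.zero_apply] at hk
    linarith
  simp only [integral_const, probReal_univ, one_smul] at hle
  linarith

theorem lintegral_pow_measure {p : Measure ℕ} [IsProbabilityMeasure p] {x : ℝ≥0∞} (hx : x ≤ 1) :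
    (∫⁻ k, x ^ k ∂p).toReal = ∫ k : ℕ, x.toReal ^ k ∂p := by
  rw [integral_eq_lintegral_of_nonneg_ae (ae_of_all _ fun k => by positivity)
    measurable_from_top.aestronglyMeasurable]
  congr 1
  refine lintegral_congr fun k => ?_
  rw [← ENNReal.toReal_pow, ENNReal.ofReal_toReal]
  exact ENNReal.pow_ne_top (ne_top_of_le_ne_top ENNReal.one_ne_top hx)

/-- The generation sizes of the tree grow at least like a multiple of `m ^ n`. -/
def GrowsLike (m : ℝ) (ξ : UHNVertex → ℕ) : Prop :=
  ∃ c : ℝ, 0 < c ∧ ∀ᶠ n in atTop, c * m ^ n ≤ (generationSize n ξ : ℝ)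

theorem measurableSet_growsLike {m : ℝ} (hm : 1 < m) : MeasurableSet {ξ | GrowsLike m ξ} := by
  have h : {ξ | GrowsLike m ξ} = ⋃ j : ℕ, ⋃ N : ℕ, ⋂ n : ℕ, ⋂ _ : N ≤ n,
      {ξ | 1 / ((j : ℝ) + 1) * m ^ n ≤ (generationSize n ξ : ℝ)} := by
    ext ξ
    simp only [GrowsLike, Set.mem_iUnion, Set.mem_iInter, Set.mem_ofPred_eq]
    constructor
    · rintro ⟨c, hc, h⟩
      obtain ⟨j, hj⟩ := exists_nat_one_div_lt hc
      obtain ⟨N, hN⟩ := eventually_atTop.1 h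
      exact ⟨j, N, fun n hn => (mul_le_mul_of_nonneg_right hj.le (by positivity)).trans (hN n hn)⟩
    · rintro ⟨j, N, h⟩
      exact ⟨1 / ((j : ℝ) + 1), by positivity, eventually_atTop.2 ⟨N, h⟩⟩
  rw [h]
  exact MeasurableSet.iUnion fun j => MeasurableSet.iUnion fun N => MeasurableSet.iInter fun n =>
    MeasurableSet.iInter fun _ => measurableSet_le measurable_const
      ((measurable_from_top (f := fun n : ℕ => (n : ℝ))).comp (measurable_generationSize n))

theorem GrowsLike.of_child {m : ℝ} (hm : 1 < m) {ξ : UHNVertex → ℕ} {i : ℕ} (hi : i < ξ [])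
    (h : GrowsLike m (offspringShift i ξ)) : GrowsLike m ξ := by
  obtain ⟨c, hc, h⟩ := h
  -- Division by `m` absorbs the shift of one generation.
  refine ⟨c / m, by positivity, ?_⟩
  obtain ⟨N, hN⟩ := eventually_atTop.1 h
  refine eventually_atTop.2 ⟨N + 1, fun n hn => ?_⟩
  obtain ⟨k, rfl⟩ : ∃ k, n = k + 1 := ⟨n - 1, by omega⟩
  have h1 : generationSize k (offspringShift i ξ) ≤ generationSize (k + 1) ξ :=
    Finset.single_le_sum (f := fun i => generationSize k (offspringShift i ξ))
      (fun _ _ => Nat.zero_le _) (Finset.mem_range.2 hi)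
  calc c / m * m ^ (k + 1) = c * m ^ k := by
        have : m ≠ 0 := by linarith
        field_simp
        ring
    _ ≤ generationSize k (offspringShift i ξ) := hN k (by omega)
    _ ≤ _ := by exact_mod_cast h1

theorem generationSize_eq_zero_mono {ξ : UHNVertex → ℕ} {n k : ℕ} (hnk : n ≤ k)
    (h : generationSize n ξ = 0) : generationSize k ξ = 0 := by
  induction k, hnk using Nat.le_induction with
  | base => exact h
  | succ k _ ih =>
    rw [generationSize, ← sum_treeGeneration, Finset.sum_const, smul_eq_mul, mul_one,
      Finset.card_eq_zero, Set.Finite.toFinset_eq_empty] at ih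
    rw [generationSize_succ', ← sum_treeGeneration]
    simp [ih]

/-- Extinction of the tree. -/
def Extinct (ξ : UHNVertex → ℕ) : Prop := ∃ n, generationSize n ξ = 0

theorem measurableSet_extinct : MeasurableSet {ξ | Extinct ξ} := by
  have h : {ξ | Extinct ξ} = ⋃ n, generationSize n ⁻¹' {0} := by
    ext ξ
    simp [Extinct]
  rw [h]
  exact MeasurableSet.iUnion fun n => measurable_generationSize n (measurableSet_singleton _)

theorem Extinct.of_children {ξ : UHNVertex → ℕ} (h : ∀ i < ξ [], Extinct (offspringShift i ξ)) :
    Extinct ξ := by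
  choose! N hN using h
  refine ⟨(Finset.range (ξ [])).sup N + 1, ?_⟩
  rw [generationSize_succ]
  refine Finset.sum_eq_zero fun i hi => ?_
  exact generationSize_eq_zero_mono (Finset.le_sup hi) (hN i (Finset.mem_range.1 hi))

theorem Extinct.not_growsLike {m : ℝ} (hm : 1 < m) {ξ : UHNVertex → ℕ} (h : Extinct ξ) :
    ¬ GrowsLike m ξ := by
  rintro ⟨c, hc, hg⟩
  obtain ⟨n, hn⟩ := h
  obtain ⟨k, hk, hnk⟩ := (hg.and (eventually_ge_atTop n)).exists
  rw [generationSize_eq_zero_mono hnk hn, Nat.cast_zero] at hk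
  have : 0 < c * m ^ k := by positivity
  linarith

variable {p : Measure ℕ} [IsProbabilityMeasure p] {m : ℝ}

/-- A positive martingale limit forces growth with half that limit as constant; without growth the
limit would be almost surely nonpositive, against its mean `1`. -/
theorem measure_not_growsLike_ne_one (hm : 1 < m)
    (hsq : Integrable (fun k : ℕ => (k : ℝ) ^ 2) p) (hmean : ∫ k : ℕ, (k : ℝ) ∂p = m) :
    (Measure.infinitePi fun _ : UHNVertex => p) {ξ | GrowsLike m ξ}ᶜ ≠ 1 := by
  intro h
  rw [prob_compl_eq_one_iff (measurableSet_growsLike hm)] at h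
  have h1 : ∀ᵐ ξ ∂(Measure.infinitePi fun _ : UHNVertex => p), ¬ GrowsLike m ξ := by
    rw [ae_iff]
    simpa using h
  have h2 : ∫ ξ, (1 + ∑' i, generationNoise m i ξ / m ^ (i + 1))
      ∂(Measure.infinitePi fun _ : UHNVertex => p) ≤ 0 := by
    refine integral_nonpos_of_ae ?_
    filter_upwards [h1, ae_lt_top (measurable_sizeBound m)
      (lintegral_sizeBound_ne_top hm hsq hmean)] with ξ hξ hfin
    by_contra! hpos
    simp only [Pi.zero_apply] at hpos
    have hlim := (summable_noise hm (noiseEnergy_ne_top hm hfin.ne)).hasSum.tendsto_sum_nat.const_add 1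
    simp only [← generationSize_eq m hm] at hlim
    refine hξ ⟨_, half_pos hpos, ?_⟩
    filter_upwards [hlim.eventually (lt_mem_nhds (half_lt_self hpos))] with n hn
    rw [lt_div_iff₀ (by positivity)] at hn
    exact hn.le
  rw [integral_limit_eq_one hm hsq hmean] at h2
  linarith

/-- Almost surely, the tree dies out or its generation sizes grow exponentially. -/
theorem ae_extinct_or_growsLike (hm : 1 < m)
    (hsq : Integrable (fun k : ℕ => (k : ℝ) ^ 2) p) (hmean : ∫ k : ℕ, (k : ℝ) ∂p = m) :
    ∀ᵐ ξ ∂(Measure.infinitePi fun _ : UHNVertex => p), Extinct ξ ∨ GrowsLike m ξ := by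
  set μ := Measure.infinitePi fun _ : UHNVertex => p
  have hGm := (measurableSet_growsLike hm).compl
  -- One implication per event suffices: extinction of all child subtrees causes extinction, and
  -- growth of one child subtree causes growth. These give the two inequalities for the generating
  -- function.
  have hE : ∫⁻ k, μ {ξ | Extinct ξ} ^ k ∂p ≤ μ {ξ | Extinct ξ} := by
    rw [← measure_forall_child p measurableSet_extinct]
    exact measure_mono fun ξ hξ => Extinct.of_children hξ
  have hG : μ {ξ | GrowsLike m ξ}ᶜ ≤ ∫⁻ k, μ {ξ | GrowsLike m ξ}ᶜ ^ k ∂p := by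
    rw [← measure_forall_child p hGm]
    exact measure_mono fun ξ hξ i hi hg => hξ (GrowsLike.of_child hm hi hg)
  have hfin : ∀ S : Set (UHNVertex → ℕ), ∫⁻ k, μ S ^ k ∂p ≠ ∞ := fun S => by
    refine ne_top_of_le_ne_top ENNReal.one_ne_top
      ((lintegral_mono fun k => pow_le_one₀ zero_le prob_le_one).trans ?_)
    simp
  have hle : μ {ξ | GrowsLike m ξ}ᶜ ≤ μ {ξ | Extinct ξ} := by
    rw [← ENNReal.toReal_le_toReal (measure_ne_top _ _) (measure_ne_top _ _)]
    refine le_of_generatingFunction (p := p) (by rwa [hmean]) ENNReal.toReal_nonneg ?_ ?_ ?_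
    · rw [← ENNReal.toReal_one, ENNReal.toReal_lt_toReal (measure_ne_top _ _) ENNReal.one_ne_top]
      exact lt_of_le_of_ne prob_le_one (measure_not_growsLike_ne_one hm hsq hmean)
    · rw [← lintegral_pow_measure prob_le_one]
      exact ENNReal.toReal_mono (measure_ne_top _ _) hE
    · rw [← lintegral_pow_measure prob_le_one]
      exact ENNReal.toReal_mono (hfin _) hG
  have hsub : {ξ | Extinct ξ} ⊆ {ξ | GrowsLike m ξ}ᶜ := fun ξ hξ => Extinct.not_growsLike hm hξ
  have hae := ae_eq_of_subset_of_measure_ge hsub hle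
    measurableSet_extinct.nullMeasurableSet (measure_ne_top _ _)
  filter_upwards [hae] with ξ hξ
  by_contra! hcon
  have : ξ ∈ {ξ | Extinct ξ} := hξ.mpr hcon.2
  exact hcon.1 this

end Survival

/-! ### Almost sure validity of the criterion -/

section Conclusion

theorem generationSum_ne_top_of_tsum {m : ℝ} (hm : 1 < m) {ξ : UHNVertex → ℕ}
    (h : ∑' n : ℕ, ENNReal.ofReal (1 / m ^ (2 * n)) *
      ∑ j ∈ Finset.range (n + 1), generationSum (sizeBound m) j ξ ≠ ∞) (n : ℕ) :
    ∑ w ∈ (finite_treeUpTo (finite_treeGeneration ξ) n).toFinset,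
      sizeBound m (offspringAbove w ξ) ≠ ∞ := by
  have h1 := ENNReal.ne_top_of_tsum_ne_top h n
  rw [← sum_treeUpTo] at h1
  intro h2
  rw [h2, ENNReal.mul_top] at h1
  · exact h1 rfl
  · exact (ENNReal.ofReal_pos.2 (by positivity)).ne'

/-- Applies the criterion with `b w` the square root of `sizeBound` on the subtree above `w`. -/
theorem assumptions_of_growsLike {m : ℝ} (hm : 1 < m) {ξ : UHNVertex → ℕ}
    (h : ∑' n : ℕ, ENNReal.ofReal (1 / m ^ (2 * n)) *
      ∑ j ∈ Finset.range (n + 1), generationSum (sizeBound m) j ξ ≠ ∞)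
    (hg : GrowsLike m ξ) (hne : ∀ n, (treeGeneration (treeOfOffspring ξ) n).Nonempty)
    {A : ℕ → Set UHNVertex} (hA1 : ∀ n, treeGeneration (treeOfOffspring ξ) n ⊆ A n)
    (hA2 : ∀ n, A n ⊆ treeUpTo (treeOfOffspring ξ) n) :
    GeometricalAssumption A ∧ AncestralAssumption A := by
  obtain ⟨c, hc, hgrow⟩ := hg
  simp only [← ncard_treeGeneration] at hgrow
  have hfin := generationSum_ne_top_of_tsum hm h
  have hbd : ∀ w ∈ treeOfOffspring ξ, sizeBound m (offspringAbove w ξ) ≠ ∞ := fun w hw =>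
    ENNReal.sum_ne_top.1 (hfin w.height) w ((Set.Finite.mem_toFinset _).2 ⟨hw, le_rfl⟩)
  have hb : ∀ w ∈ treeOfOffspring ξ, ∀ j,
      ((treeGeneration (subtreeAt w (treeOfOffspring ξ)) j).ncard : ℝ) ≤
        m ^ j * √(sizeBound m (offspringAbove w ξ)).toReal := fun w hw j => by
    rw [subtreeAt_treeOfOffspring hw, ncard_treeGeneration]
    exact generationSize_le hm (hbd w hw) j
  have hlim : Tendsto (fun n => (∑ w ∈ (finite_treeUpTo (finite_treeGeneration ξ) n).toFinset,
      √(sizeBound m (offspringAbove w ξ)).toReal ^ 2) / m ^ (2 * n)) atTop (𝓝 0) := by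
    have h1 := (ENNReal.tendsto_toReal ENNReal.zero_ne_top).comp
      (ENNReal.tendsto_atTop_zero_of_tsum_ne_top h)
    rw [ENNReal.toReal_zero] at h1
    refine h1.congr fun n => ?_
    simp only [Function.comp_apply]
    rw [← sum_treeUpTo, ENNReal.toReal_mul, ENNReal.toReal_ofReal (by positivity),
      ENNReal.toReal_sum (ENNReal.sum_ne_top.1 (hfin n)), one_div_mul_eq_div]
    simp only [Real.sq_sqrt ENNReal.toReal_nonneg]
  exact ⟨geometricalAssumption_of_bounds hm mem_treeOfOffspring_of_append (finite_treeGeneration ξ)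
      hb hlim hc hgrow hA1 hA2 hne,
    ancestralAssumption_of_bounds hm mem_treeOfOffspring_of_append (finite_treeGeneration ξ)
      hb hlim hc hgrow hA1 hA2 hne⟩

/-- Any measurable family squeezed between the last generation and the whole tree up to it is
covered, hence all three cases of the theorem. -/
theorem ae_assumptions {p : Measure ℕ} [IsProbabilityMeasure p]
    (hp_sq : Integrable (fun k : ℕ => (k : ℝ) ^ 2) p) (hp_mean : 1 < ∫ k : ℕ, (k : ℝ) ∂p)
    {Ω : Type*} [MeasurableSpace Ω] {P : Measure Ω} {T : Ω → Set UHNVertex}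
    (hT : IsConditionedBGWTree p T P) {B : ℕ → Set UHNVertex → Set UHNVertex}
    (hB : ∀ n, Measurable (B n)) (hB1 : ∀ n t, treeGeneration t n ⊆ B n t)
    (hB2 : ∀ n t, B n t ⊆ treeUpTo t n) :
    ∀ᵐ ω ∂P, GeometricalAssumption (fun n => B n (T ω)) ∧
      AncestralAssumption (fun n => B n (T ω)) := by
  set good := {t | GeometricalAssumption (fun n => B n t) ∧ AncestralAssumption (fun n => B n t)}
  have hgood : MeasurableSet good := measurableSet_geometrical_ancestral hB
  have h1 : ∀ᵐ t ∂(bgwLaw p), t ∈ survivalEvent → t ∈ good := by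
    have hm : MeasurableSet {t | t ∈ survivalEvent → t ∈ good} := by
      have : {t | t ∈ survivalEvent → t ∈ good} = survivalEventᶜ ∪ good := by
        ext t
        simp [imp_iff_not_or]
      rw [this]
      exact measurableSet_survivalEvent.compl.union hgood
    unfold bgwLaw
    rw [ae_map_iff measurable_treeOfOffspring.aemeasurable hm]
    filter_upwards [ae_extinct_or_growsLike hp_mean hp_sq rfl,
      ae_tsum_generationSum_ne_top hp_mean hp_sq rfl] with ξ hξ hsum hsurv
    refine assumptions_of_growsLike hp_mean hsum (hξ.resolve_left ?_) hsurv (fun n => hB1 n _)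
      fun n => hB2 n _
    rintro ⟨n, hn⟩
    rw [← ncard_treeGeneration, Set.ncard_eq_zero (finite_treeGeneration ξ n)] at hn
    exact (hsurv n).ne_empty hn
  -- The conditional law is a multiple of the restriction to survival.
  have h2 : ∀ᵐ t ∂(ProbabilityTheory.cond (bgwLaw p) survivalEvent), t ∈ good :=
    Measure.ae_smul_measure ((ae_restrict_iff' measurableSet_survivalEvent).2 h1) _
  rw [← hT.map_eq] at h2
  exact ae_of_ae_map hT.aemeasurable h2

end Conclusion

theorem mainTheorem3
    (p : Measure ℕ) [IsProbabilityMeasure p]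
    (hp_sq : Integrable (fun k : ℕ => (k : ℝ) ^ 2) p)
    (hp_mean : 1 < ∫ k : ℕ, (k : ℝ) ∂p)
    {Ω : Type*} [MeasurableSpace Ω] (P : Measure Ω) [IsProbabilityMeasure P]
    (T : Ω → Set UHNVertex) (hT : IsConditionedBGWTree p T P) :
    (∀ l : ℕ → ℕ, (∀ n, l n ≤ n) →
      ∀ᵐ ω ∂P,
        GeometricalAssumption (fun n => lastGenerations (T ω) n (l n)) ∧
        AncestralAssumption (fun n => lastGenerations (T ω) n (l n))) ∧
    (∀ᵐ ω ∂P,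
      GeometricalAssumption (fun n => treeGeneration (T ω) n) ∧
      AncestralAssumption (fun n => treeGeneration (T ω) n)) ∧
    (∀ᵐ ω ∂P,
      GeometricalAssumption (fun n => treeUpTo (T ω) n) ∧
      AncestralAssumption (fun n => treeUpTo (T ω) n)) := by
  refine ⟨fun l _ => ?_, ?_, ?_⟩
  · refine ae_assumptions hp_sq hp_mean hT (B := fun n t => lastGenerations t n (l n))
      (fun n => measurable_lastGenerations n (l n)) (fun n t u hu => ?_) fun n t u hu => ?_
    · exact mem_lastGenerations_iff.2 ⟨hu.1, hu.2.symm ▸ Nat.sub_le _ _, hu.2.le⟩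
    · have h := mem_lastGenerations_iff.1 hu
      exact ⟨h.1, h.2.2⟩
  · exact ae_assumptions hp_sq hp_mean hT (B := fun n t => treeGeneration t n)
      measurable_treeGeneration (fun n t => subset_rfl) fun n t u hu => ⟨hu.1, hu.2.le⟩
  · exact ae_assumptions hp_sq hp_mean hT (B := fun n t => treeUpTo t n)
      measurable_treeUpTo (fun n t u hu => ⟨hu.1, hu.2.le⟩) fun n t => subset_rfl
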